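/- Let $n\in\{2,3\}$, let $p\in[3,\infty]$ if $n=3$ and $p\in(2,\infty]$ if $n=2$, let $\delta>\frac{n+1}{2}-\frac np$ (with $n/\infty=0$) and $\mu>2$. For $\sigma\in\mathbb R$ let $L^p_\sigma(\mathbb R^n)$ be the space of $f$ with $(1+|x|^2)^{\sigma/2}f\in L^p(\mathbb R^n)$, and let $H^1_\sigma(\mathbb R^n)$ be the space of complex-valued $f\in L^2_\sigma$ whose weak gradient $\nabla f$ belongs to $L^2_\sigma$. Let $W:\mathbb R^n\to\mathbb R^n$ and $V:\mathbb R^n\to\mathbb R$ satisfy $W\in L^\infty_\delta(\mathbb R^n)$, $V\in L^p_{\rm loc}(\mathbb R^n)$, suppose that the weak divergence $\nabla\cdot W$ exists and belongs to $L^p_\delta(\mathbb R^n)$, and that for some constants $c,R$ $$|V(x)|,\ |W(x)|,\ |\nabla\cdot W(x)|\le \frac{c}{|x|^{\mu}}\qquad\text{for almost all } |x|\ge R .$$ Put $\tilde q=|W|^2+V$ and, for $k>0$ and $r>0$, $$G_k^+(r)=\frac i4\Big(\frac{k}{2\pi r}\Big)^{\frac{n-2}{2}}H^{(1)}_{\frac{n-2}{2}}(kr),$$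 where $H^{(1)}_\nu$ is the Hankel function of the first kind, so that $G_k^+(|x-y|)$ is the kernel of $(-\Delta-k^2-i0)^{-1}$. For a function $f$ let $$Sf=i\,\nabla\cdot(Wf)+i\,W\cdot\nabla f-\tilde q f,\qquad L_kf(x)=\int_{\mathbb R^n}G_k^+(|x-y|)\,Sf(y)\,dy,$$ with weak derivatives. Let $\frac12<\delta_0<\frac{\mu-1}{2}$ (such $\delta_0$ exist since $\mu>2$). Then for every $k>0$ and every $f\in H^1_{-\delta_0}(\mathbb R^n)$ the weak divergence $\nabla\cdot(Wf)$ exists, $Sf\in L^1(\mathbb R^n)$, the integral defining $L_kf(x)$ converges absolutely for all $x$ with $|x|$ sufficiently large, and $$L_kf(x)=c_n\,\frac{e^{ik|x|}k^{\frac{n-3}{2}}}{|x|^{\frac{n-1}{2}}}\int_{\mathbb R^n}e^{-ik(\theta',y)}\,Sf(y)\,dy+o\Big(\frac1{|x|^{\frac{n-1}{2}}}\Big),\qquad |x|\to\infty,\quad \theta'=\frac{x}{|x|},$$ where the remainder is uniform in the direction $\theta'$ and $c_n=\dfrac{e^{-i\pi(n-3)/4}}{2(2\pi)^{(n-1)/2}}$,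 that is, $c_3=\frac1{4\pi}$ and $c_2=\frac{e^{i\pi/4}}{\sqrt{8\pi}}$. -/

import Mathlib

open MeasureTheory Asymptotics Bornology
open scoped ContDiff ENNReal

noncomputable section

namespace MagneticScattering

/-- `ℝⁿ` with the Euclidean norm. -/
abbrev Rn (n : ℕ) : Type := EuclideanSpace ℝ (Fin n)

/-- `𝕜`-valued vector fields take values in `𝕜ⁿ` with the Euclidean norm. -/
abbrev Vec (𝕜 : Type) (n : ℕ) : Type := EuclideanSpace 𝕜 (Fin n)

/-! ### Bessel and Hankel functions of a positive argument -/

/-- Bessel function of the first kind `J_ν(z)`, for real `ν` and `z > 0`, by the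
Bessel–Schläfli integral. -/
def besselJ (ν z : ℝ) : ℝ :=
  (1 / Real.pi) * (∫ θ in (0 : ℝ)..Real.pi, Real.cos (z * Real.sin θ - ν * θ))
    - (Real.sin (ν * Real.pi) / Real.pi)
      * ∫ t in Set.Ioi (0 : ℝ), Real.exp (-z * Real.sinh t - ν * t)

/-- Bessel function of the second kind `Y_ν(z)`, for real `ν` and `z > 0`, by the
Bessel–Schläfli integral. -/
def besselY (ν z : ℝ) : ℝ :=
  (1 / Real.pi) * (∫ θ in (0 : ℝ)..Real.pi, Real.sin (z * Real.sin θ - ν * θ))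
    - (1 / Real.pi)
      * ∫ t in Set.Ioi (0 : ℝ),
          (Real.exp (ν * t) + Real.exp (-ν * t) * Real.cos (ν * Real.pi))
            * Real.exp (-z * Real.sinh t)

/-- Hankel function of the first kind, `H_ν^{(1)} = J_ν + i Y_ν`. -/
def hankelH1 (ν z : ℝ) : ℂ := (besselJ ν z : ℂ) + Complex.I * (besselY ν z : ℂ)

/-- The outgoing kernel `G_k^+(r)` of `(-Δ - k² - i0)⁻¹` on `ℝⁿ`,
`(i/4) (k / (2πr))^{(n-2)/2} H^{(1)}_{(n-2)/2}(kr)`. -/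
def greenFn (n : ℕ) (k r : ℝ) : ℂ :=
  (Complex.I / 4) * (((k / (2 * Real.pi * r)) ^ (((n : ℝ) - 2) / 2) : ℝ) : ℂ)
    * hankelH1 (((n : ℝ) - 2) / 2) (k * r)

/-- The dimensional constant `c_n = e^{-iπ(n-3)/4} / (2 (2π)^{(n-1)/2})`; so `c_3 = 1/(4π)` and
`c_2 = e^{iπ/4} / √(8π)`. -/
def farFieldConst (n : ℕ) : ℂ :=
  Complex.exp (-(Complex.I * (Real.pi : ℂ) * (((n : ℂ) - 3) / 4)))
    / ((2 * (2 * Real.pi) ^ (((n : ℝ) - 1) / 2) : ℝ) : ℂ)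

/-! ### Weak derivatives and weighted spaces -/

/-- The classical partial derivative `∂_i φ (x)`. -/
def pderiv {n : ℕ} (i : Fin n) (φ : Rn n → ℝ) (x : Rn n) : ℝ :=
  fderiv ℝ φ x (EuclideanSpace.single i (1 : ℝ))

/-- Real-valued test functions, `φ ∈ C_c^∞(ℝⁿ)`. -/
def IsTestFn {n : ℕ} (φ : Rn n → ℝ) : Prop := ContDiff ℝ ∞ φ ∧ HasCompactSupport φ

/-- `g` is the weak (distributional) gradient of `f`. -/
def IsWeakGrad {n : ℕ} (f : Rn n → ℂ) (g : Rn n → Vec ℂ n) : Prop :=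
  LocallyIntegrable f volume ∧ LocallyIntegrable g volume ∧
    ∀ φ : Rn n → ℝ, IsTestFn φ → ∀ i : Fin n,
      ∫ x, pderiv i φ x • f x = -∫ x, φ x • g x i

/-- `d` is the weak (distributional) divergence of the vector field `F`. -/
def IsWeakDiv {𝕜 : Type} [RCLike 𝕜] {n : ℕ} (F : Rn n → Vec 𝕜 n) (d : Rn n → 𝕜) : Prop :=
  LocallyIntegrable F volume ∧ LocallyIntegrable d volume ∧
    ∀ φ : Rn n → ℝ, IsTestFn φ →
      ∫ x, ∑ i : Fin n, pderiv i φ x • F x i = -∫ x, φ x • d x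

open Classical in
/-- The weak gradient `∇f` (determined up to a null set when it exists; `0` otherwise). -/
def weakGrad {n : ℕ} (f : Rn n → ℂ) : Rn n → Vec ℂ n :=
  if h : ∃ g, IsWeakGrad f g then h.choose else 0

open Classical in
/-- The weak divergence `∇ · F` (determined up to a null set when it exists; `0` otherwise). -/
def weakDiv {n : ℕ} (F : Rn n → Vec ℂ n) : Rn n → ℂ :=
  if h : ∃ d, IsWeakDiv F d then h.choose else 0

/-- `f ∈ L^p_σ(ℝⁿ)`, i.e. `(1 + |x|²)^{σ/2} f ∈ L^p(ℝⁿ)`. -/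
def MemWeightedLp {n : ℕ} {F : Type} [NormedAddCommGroup F] [NormedSpace ℝ F]
    (p : ℝ≥0∞) (σ : ℝ) (f : Rn n → F) : Prop :=
  MemLp (fun x => ((1 + ‖x‖ ^ 2) ^ (σ / 2) : ℝ) • f x) p volume

/-- `f ∈ H^1_σ(ℝⁿ)`: both `f` and its weak gradient belong to `L²_σ(ℝⁿ)`. -/
def MemWeightedH1 {n : ℕ} (σ : ℝ) (f : Rn n → ℂ) : Prop :=
  MemWeightedLp 2 σ f ∧ ∃ g, IsWeakGrad f g ∧ MemWeightedLp 2 σ g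

/-- `|g(x)| ≤ c |x|^{-μ}` for (almost) all large `|x|`. -/
def DecaysLike {n : ℕ} {F : Type} [NormedAddCommGroup F] (μ : ℝ) (g : Rn n → F) : Prop :=
  ∃ c R : ℝ, ∀ᵐ x : Rn n, R ≤ ‖x‖ → ‖g x‖ ≤ c / ‖x‖ ^ μ

/-- The assumptions on the magnetic potential `W` and the electric potential `V`. -/
structure Admissible {n : ℕ} (p : ℝ≥0∞) (δ μ : ℝ) (W : Rn n → Rn n) (V : Rn n → ℝ) : Prop where
  /-- `W ∈ L^∞_δ`. -/
  W_mem : MemWeightedLp ⊤ δ W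
  /-- `∇ · W` exists weakly, belongs to `L^p_δ` and decays like `|x|^{-μ}`. -/
  divW : ∃ d : Rn n → ℝ, IsWeakDiv (𝕜 := ℝ) W d ∧ MemWeightedLp p δ d ∧ DecaysLike μ d
  /-- `V ∈ L^p_loc`. -/
  V_mem : ∀ K : Set (Rn n), IsCompact K → MemLp V p (volume.restrict K)
  /-- `W` decays like `|x|^{-μ}`. -/
  W_decay : DecaysLike μ W
  /-- `V` decays like `|x|^{-μ}`. -/
  V_decay : DecaysLike μ V

/-! ### The integral operator -/

/-- The complex vector field `W f`. -/
def mulField {n : ℕ} (W : Rn n → Rn n) (f : Rn n → ℂ) (x : Rn n) : Vec ℂ n :=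
  WithLp.toLp 2 fun i => (W x i : ℂ) * f x

/-- `i ∇·(W f) + i W·∇f - q̃ f` with `q̃ = |W|² + V`. -/
def source {n : ℕ} (W : Rn n → Rn n) (V : Rn n → ℝ) (f : Rn n → ℂ) (y : Rn n) : ℂ :=
  Complex.I * weakDiv (mulField W f) y
    + Complex.I * (∑ i : Fin n, (W y i : ℂ) * weakGrad f y i)
    - ((‖W y‖ ^ 2 + V y : ℝ) : ℂ) * f y

/-- The operator `L_k f(x) = ∫ G_k^+(|x - y|) (i ∇·(W f) + i W·∇f - q̃ f)(y) dy`. -/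
def Lk {n : ℕ} (W : Rn n → Rn n) (V : Rn n → ℝ) (k : ℝ) (f : Rn n → ℂ) (x : Rn n) : ℂ :=
  ∫ y, greenFn n k ‖x - y‖ * source W V f y

/-- `∫ e^{-ik(θ, y)} (i ∇·(W f) + i W·∇f - q̃ f)(y) dy`. -/
def farFieldIntegral {n : ℕ} (W : Rn n → Rn n) (V : Rn n → ℝ) (k : ℝ) (f : Rn n → ℂ)
    (θ : Rn n) : ℂ :=
  ∫ y, Complex.exp (-(Complex.I * (k : ℂ) * ((inner ℝ θ y : ℝ) : ℂ))) * source W V f y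

end MagneticScattering

end

open MagneticScattering

/-! The source `Sf` is integrable, and at infinity it is at most a constant times `|y|^{-a} h(y)`
with `h ∈ L²` and `a = μ - δ₀`. The hypotheses on `δ₀` give `a > 3/2 ≥ n/2`. Everything else
concerns the kernel, through two facts with `s = (n-1)/2`: `r^s |G_k^+(r)|` is bounded for all `r >
0`, and `r^s e^{-ikr} G_k^+(r)` converges to `c_n k^{(n-3)/2}` as `r → ∞`.

Multiply the remainder by `|x|^s` and cut at `|x - y| = |x|/2`. Outside that ball `|x|^s G_k^+(|x -
y|)` is bounded, and for fixed `y` it approaches the plane wave because `|x - y| = |x| - (θ', y) +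
o(1)`. Dominated convergence against `|Sf|` disposes of this part. Inside the ball `|y| ≥ |x|/2`, so
the plane wave integral there tends to zero, and the decay of `Sf` together with the local square
integrability of `r^{-s}` bounds the kernel integral by `|x|^{1/2-a}`, that is `|x|^{n/2-a} → 0`
after rescaling (`exists_near_bound`, `farField_expansion`). All limits are taken along `cobounded`,
with no direction fixed, which is what makes the remainder uniform in `θ'`.

The kernel facts come from the Bessel–Schläfli integrals: the oscillating part reduces to Fresnel
integrals (`sqrt_mul_schlafliHalf`), and the rest is `O(z^{-1/2})` everywhere and `O(1/z)` at
infinity (`norm_hankelTail_le`). The source facts rest on the product rule `∇·(Wf) = (∇·W) f + W·∇f`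
(`isWeakDiv_mulField`), valid because every factor is locally square integrable; it is proved by
mollifying `f` (`source_estimate`). -/

namespace MagneticScattering

open Filter Topology Set

/-! ### The Fresnel integral -/

theorem norm_exp_neg_mul_sq_le {b : ℂ} (hb : 0 ≤ b.re) (u : ℝ) :
    ‖Complex.exp (-b * (u : ℂ) ^ 2)‖ ≤ 1 := by
  rw [Complex.norm_exp, ← Complex.ofReal_pow, Complex.re_mul_ofReal, Complex.neg_re]
  exact Real.exp_le_one_iff.2 (by nlinarith [sq_nonneg u])

theorem continuous_exp_neg_mul_sq (b : ℂ) :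
    Continuous fun u : ℝ => Complex.exp (-b * (u : ℂ) ^ 2) := by fun_prop

/-- One integration by parts with primitive `P`: the boundary terms cost `1/(2X) + 1/(2Y)` and the
leftover integral `1/(2X) - 1/(2Y)`. The bound does not depend on `b`, so it survives the passage to
the imaginary axis. -/
theorem norm_integral_exp_neg_mul_sq_le {b : ℂ} (hb : 0 ≤ b.re) (hb1 : 1 ≤ ‖b‖) {X Y : ℝ}
    (hX : 0 < X) (hXY : X ≤ Y) :
    ‖∫ u in X..Y, Complex.exp (-b * (u : ℂ) ^ 2)‖ ≤ 1 / X := by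
  have hb0 : b ≠ 0 := by
    rintro rfl; norm_num at hb1
  have hpos : ∀ u ∈ uIcc X Y, 0 < u := fun u hu => by
    rw [uIcc_of_le hXY] at hu; exact hX.trans_le hu.1
  set P : ℝ → ℂ := fun u => -(Complex.exp (-b * (u : ℂ) ^ 2) / (2 * b * u)) with hP
  have hnorm : ∀ u : ℝ, 0 < u → ‖P u‖ ≤ 1 / (2 * u) := fun u hu => by
    simp only [hP, norm_neg, norm_div, norm_mul, Complex.norm_real, Real.norm_eq_abs,
      abs_of_pos hu, Complex.norm_ofNat]
    have := norm_exp_neg_mul_sq_le hb u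
    gcongr
    nlinarith
  have hder : ∀ u ∈ uIcc X Y, HasDerivAt P
      (Complex.exp (-b * (u : ℂ) ^ 2) + Complex.exp (-b * (u : ℂ) ^ 2) / (2 * b * u ^ 2)) u := by
    intro u hu
    have hu0 : (u : ℂ) ≠ 0 := by exact_mod_cast (hpos u hu).ne'
    have h1 : HasDerivAt (fun u : ℝ => (u : ℂ)) 1 u := Complex.ofRealCLM.hasDerivAt
    have h2 := (((h1.pow 2).const_mul (-b)).cexp).div (h1.const_mul (2 * b)) (by simp [hb0, hu0])
    refine h2.neg.congr_deriv ?_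
    simp only [Pi.pow_apply]
    field_simp
    ring
  have hc1 := continuous_exp_neg_mul_sq b
  have hc2 : ContinuousOn
      (fun u : ℝ => Complex.exp (-b * (u : ℂ) ^ 2) / (2 * b * u ^ 2)) (uIcc X Y) := by
    refine hc1.continuousOn.div (by fun_prop) fun u hu => ?_
    have hu0 : (u : ℂ) ≠ 0 := by exact_mod_cast (hpos u hu).ne'
    simp [hb0, hu0]
  have hftc := intervalIntegral.integral_eq_sub_of_hasDerivAt hder
    ((hc1.continuousOn.add hc2).intervalIntegrable)
  rw [intervalIntegral.integral_add (hc1.intervalIntegrable _ _) hc2.intervalIntegrable] at hftc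
  have hrd : ∀ u ∈ uIcc X Y, HasDerivAt (fun u : ℝ => -(1 / (2 * u))) (1 / (2 * u ^ 2)) u := by
    intro u hu
    have hu0 := (hpos u hu).ne'
    have := ((hasDerivAt_id u).const_mul 2).inv (by simpa using hu0)
    refine (this.neg.congr_deriv ?_).congr_of_eventuallyEq (Eventually.of_forall fun v => ?_)
    · simp only [id]; field_simp
    · simp
  have hrc : ContinuousOn (fun u : ℝ => 1 / (2 * u ^ 2)) (uIcc X Y) :=
    continuousOn_const.div (by fun_prop) fun u hu => by
      have := (hpos u hu).ne'; positivity
  have hr := intervalIntegral.integral_eq_sub_of_hasDerivAt hrd hrc.intervalIntegrable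
  have hbd : ‖∫ u in X..Y, Complex.exp (-b * (u : ℂ) ^ 2) / (2 * b * u ^ 2)‖
      ≤ ∫ u in X..Y, 1 / (2 * u ^ 2) := by
    refine intervalIntegral.norm_integral_le_of_norm_le hXY (Eventually.of_forall fun u hu => ?_)
      hrc.intervalIntegrable
    have hu0 : 0 < u := hX.trans hu.1
    simp only [norm_div, norm_mul, norm_pow, Complex.norm_real, Real.norm_eq_abs,
      abs_of_pos hu0, Complex.norm_ofNat]
    have := norm_exp_neg_mul_sq_le hb u
    gcongr
    nlinarith
  rw [hr] at hbd
  rw [eq_sub_of_add_eq hftc]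
  have hY := hnorm Y (hX.trans_le hXY)
  have hX' := hnorm X hX
  calc _ ≤ ‖P Y‖ + ‖P X‖ + _ := (norm_sub_le _ _).trans (add_le_add_left (norm_sub_le _ _) _)
    _ ≤ 1 / (2 * Y) + 1 / (2 * X) + (-(1 / (2 * Y)) - -(1 / (2 * X))) := by gcongr
    _ = 1 / X := by field_simp; ring

theorem norm_gaussian_sub_integral_le {b : ℂ} (hb : 0 < b.re) (hb1 : 1 ≤ ‖b‖) {X : ℝ}
    (hX : 0 < X) :
    ‖(Real.pi / b) ^ (1 / 2 : ℂ) / 2 - ∫ u in (0 : ℝ)..X, Complex.exp (-b * (u : ℂ) ^ 2)‖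
      ≤ 1 / X := by
  have hInt : Integrable fun u : ℝ => Complex.exp (-b * (u : ℂ) ^ 2) :=
    integrable_cexp_neg_mul_sq hb
  have h := intervalIntegral_tendsto_integral_Ioi 0 hInt.integrableOn tendsto_id
  rw [integral_gaussian_complex_Ioi hb] at h
  refine le_of_tendsto (h.sub_const _).norm ?_
  filter_upwards [eventually_ge_atTop X] with Y hY
  rw [id, intervalIntegral.integral_interval_sub_left (hInt.intervalIntegrable)
    (hInt.intervalIntegrable)]
  exact norm_integral_exp_neg_mul_sq_le hb.le hb1 hX hY

/-- The Fresnel integral `∫₀^X e^{-iu²} du`. -/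
noncomputable def fresnel (X : ℝ) : ℂ :=
  ∫ u in (0 : ℝ)..X, Complex.exp (-Complex.I * (u : ℂ) ^ 2)

/-- The limit at infinity of the Fresnel integral. -/
noncomputable def fresnelLim : ℂ :=
  (Real.sqrt Real.pi / 2 : ℝ) * Complex.exp (-(Real.pi / 4 : ℝ) * Complex.I)

theorem gaussian_value_eq_fresnelLim :
    ((Real.pi : ℂ) / Complex.I) ^ (1 / 2 : ℂ) / 2 = fresnelLim := by
  have h1 : (Real.pi : ℂ) / Complex.I = (Real.pi : ℝ) * (-Complex.I) := by
    rw [Complex.div_I]; ring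
  rw [h1, Complex.cpow_def_of_ne_zero (by simp [Real.pi_ne_zero]),
    Complex.log_ofReal_mul Real.pi_pos (by simp), Complex.log_neg_I, fresnelLim, add_mul,
    Complex.exp_add]
  rw [show ((Real.log Real.pi : ℝ) : ℂ) * (1 / 2) = ((Real.log Real.pi * (1 / 2) : ℝ) : ℂ) by
    push_cast; ring, ← Complex.ofReal_exp, ← Real.rpow_def_of_pos Real.pi_pos,
    ← Real.sqrt_eq_rpow]
  push_cast
  rw [show -(Real.pi / 2 : ℂ) * Complex.I * (1 / 2) = -(Real.pi / 4 : ℂ) * Complex.I by ring]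
  ring

/-- The oscillating integrand is not absolutely integrable, so the Gaussian formula is used at `b =
ε + i`. There `|b| ≥ 1`, the tail bound is uniform in `ε`, and `ε → 0⁺` is harmless on the compact
interval `[0, X]`. -/
theorem norm_fresnelLim_sub_le {X : ℝ} (hX : 0 < X) : ‖fresnelLim - fresnel X‖ ≤ 1 / X := by
  have hc : Continuous fun ε : ℝ =>
      ∫ u in (0 : ℝ)..X, Complex.exp (-((ε : ℂ) + Complex.I) * (u : ℂ) ^ 2) :=
    intervalIntegral.continuous_parametric_intervalIntegral_of_continuous' (by fun_prop) _ _
  have hg : ContinuousAt (fun ε : ℝ =>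
      ((Real.pi : ℂ) / ((ε : ℂ) + Complex.I)) ^ (1 / 2 : ℂ) / 2) 0 := by
    refine ContinuousAt.div_const (ContinuousAt.cpow ?_ continuousAt_const ?_) _
    · exact continuousAt_const.div (by fun_prop) (by simp)
    · simp [Complex.mem_slitPlane_iff, Real.pi_ne_zero]
  have hlim := ((hg.sub hc.continuousAt).norm.tendsto).mono_left
    (nhdsWithin_le_nhds (s := Ioi (0 : ℝ)))
  simp only [Pi.sub_apply, Complex.ofReal_zero, zero_add, gaussian_value_eq_fresnelLim] at hlim
  refine le_of_tendsto hlim ?_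
  filter_upwards [self_mem_nhdsWithin] with ε hε
  refine norm_gaussian_sub_integral_le (by simpa using hε) ?_ hX
  calc (1 : ℝ) = |((ε : ℂ) + Complex.I).im| := by simp
    _ ≤ _ := Complex.abs_im_le_norm _

theorem tendsto_fresnel : Tendsto fresnel atTop (𝓝 fresnelLim) := by
  rw [tendsto_iff_norm_sub_tendsto_zero]
  refine squeeze_zero' (Eventually.of_forall fun _ => norm_nonneg _) ?_
    (tendsto_inv_atTop_zero (𝕜 := ℝ))
  filter_upwards [eventually_gt_atTop 0] with X hX
  rw [norm_sub_rev, ← one_div]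
  exact norm_fresnelLim_sub_le hX

theorem norm_fresnel_le {X : ℝ} (hX : 0 ≤ X) : ‖fresnel X‖ ≤ ‖fresnelLim‖ + 1 := by
  rcases le_total X 1 with h | h
  · have : ‖fresnel X‖ ≤ 1 * |X - 0| :=
      intervalIntegral.norm_integral_le_of_norm_le_const fun u _ =>
        norm_exp_neg_mul_sq_le (by simp) u
    rw [sub_zero, abs_of_nonneg hX] at this
    linarith [norm_nonneg fresnelLim]
  · have h1 := norm_fresnelLim_sub_le (zero_lt_one.trans_le h)
    have h2 : 1 / X ≤ 1 := by rw [div_le_one (by linarith)]; exact h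
    have h3 := norm_sub_norm_le (fresnel X) fresnelLim
    rw [norm_sub_rev] at h3
    linarith

theorem hasDerivAt_fresnel (X : ℝ) :
    HasDerivAt fresnel (Complex.exp (-Complex.I * (X : ℂ) ^ 2)) X :=
  intervalIntegral.integral_hasDerivAt_right
    ((continuous_exp_neg_mul_sq _).intervalIntegrable _ _)
    (continuous_exp_neg_mul_sq _).stronglyMeasurable.stronglyMeasurableAtFilter
    (continuous_exp_neg_mul_sq _).continuousAt

/-! ### Stationary phase for the Schläfli integral -/

/-- `∫₀^{π/2} e^{iz cos φ - iνφ} dφ`. -/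
noncomputable def schlafliHalf (ν z : ℝ) : ℂ :=
  ∫ φ in (0 : ℝ)..(Real.pi / 2), Complex.exp (Complex.I * (z * Real.cos φ - ν * φ : ℝ))

/-- `e^{-iνφ} / cos (φ/2)`. -/
noncomputable def schlafliAmp (ν φ : ℝ) : ℂ :=
  Complex.exp (-Complex.I * ν * φ) / (Real.cos (φ / 2) : ℝ)

theorem cos_half_ne_zero {φ : ℝ} (h : φ ∈ Icc 0 (Real.pi / 2)) : Real.cos (φ / 2) ≠ 0 := by
  refine (Real.cos_pos_of_mem_Ioo ⟨?_, ?_⟩).ne' <;> linarith [h.1, h.2, Real.pi_pos]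

/-- The derivative of `schlafliAmp`. -/
noncomputable def schlafliAmpDeriv (ν φ : ℝ) : ℂ :=
  (Complex.exp (-Complex.I * ν * φ) * (-Complex.I * ν) * (Real.cos (φ / 2) : ℝ)
    - Complex.exp (-Complex.I * ν * φ) * (-Real.sin (φ / 2) * (1 / 2) : ℝ))
    / ((Real.cos (φ / 2) : ℝ) : ℂ) ^ 2

theorem hasDerivAt_schlafliAmp (ν : ℝ) {φ : ℝ} (h : φ ∈ Icc 0 (Real.pi / 2)) :
    HasDerivAt (schlafliAmp ν) (schlafliAmpDeriv ν φ) φ := by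
  have h1 : HasDerivAt (fun u : ℝ => (u : ℂ)) 1 φ := Complex.ofRealCLM.hasDerivAt
  have h2 : HasDerivAt (fun u : ℝ => Real.cos (u / 2)) (-Real.sin (φ / 2) * (1 / 2)) φ :=
    ((hasDerivAt_id φ).div_const 2).cos
  have h3 := ((h1.const_mul (-Complex.I * ν)).cexp).div h2.ofReal_comp
    (by exact_mod_cast cos_half_ne_zero h)
  rw [mul_one] at h3
  exact h3

theorem continuousOn_schlafliAmpDeriv (ν : ℝ) :
    ContinuousOn (schlafliAmpDeriv ν) (Icc 0 (Real.pi / 2)) := by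
  refine ContinuousOn.div (by fun_prop) (by fun_prop) fun φ h => ?_
  have := cos_half_ne_zero h
  exact pow_ne_zero _ (by exact_mod_cast this)

/-- Since `cos φ = 1 - 2 sin²(φ/2)`, the variable `√(2z) sin(φ/2)` turns the phase into an exact
square; the Jacobian puts `cos(φ/2)` under the amplitude, which stays smooth up to `π/2`.
Integrating by parts moves the oscillation into `fresnel`, which is bounded and convergent, so one
identity yields both a bound for all `z > 0` and the limit. -/
theorem sqrt_mul_schlafliHalf (ν : ℝ) {z : ℝ} (hz : 0 < z) :
    (Real.sqrt z : ℂ) * Complex.exp (-Complex.I * z) * schlafliHalf ν z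
      = Real.sqrt 2 * (fresnel (Real.sqrt (2 * z) * Real.sin (Real.pi / 4))
            * schlafliAmp ν (Real.pi / 2)
          - ∫ φ in (0 : ℝ)..(Real.pi / 2),
              fresnel (Real.sqrt (2 * z) * Real.sin (φ / 2)) * schlafliAmpDeriv ν φ) := by
  have hpi : (0 : ℝ) ≤ Real.pi / 2 := by positivity
  set s := Real.sqrt (2 * z) with hs
  have hss : s ^ 2 = 2 * z := Real.sq_sqrt (by positivity)
  have hu : ∀ φ ∈ uIcc 0 (Real.pi / 2), HasDerivAt (fun φ => fresnel (s * Real.sin (φ / 2)))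
      ((Complex.exp (-Complex.I * ((s * Real.sin (φ / 2) : ℝ) : ℂ) ^ 2))
        * (s * (Real.cos (φ / 2) * (1 / 2)) : ℝ)) φ := by
    intro φ _
    have h2 : HasDerivAt (fun u : ℝ => s * Real.sin (u / 2)) (s * (Real.cos (φ / 2) * (1 / 2))) φ :=
      (((hasDerivAt_id φ).div_const 2).sin).const_mul s
    have := (hasDerivAt_fresnel (s * Real.sin (φ / 2))).scomp φ h2
    simpa [Function.comp_def, mul_comm] using this
  have hv : ∀ φ ∈ uIcc 0 (Real.pi / 2),
      HasDerivAt (schlafliAmp ν) (schlafliAmpDeriv ν φ) φ := fun φ h => by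
    rw [uIcc_of_le hpi] at h; exact hasDerivAt_schlafliAmp ν h
  have hparts := intervalIntegral.integral_mul_deriv_eq_deriv_mul hu hv
    (Continuous.intervalIntegrable (by fun_prop) _ _)
    (ContinuousOn.intervalIntegrable (by
      rw [uIcc_of_le hpi]; exact continuousOn_schlafliAmpDeriv ν))
  have h0 : fresnel (s * Real.sin (0 / 2)) = 0 := by simp [fresnel]
  rw [h0, zero_mul, sub_zero, show Real.pi / 2 / 2 = Real.pi / 4 by ring] at hparts
  rw [hparts, sub_sub_cancel, schlafliHalf, ← intervalIntegral.integral_const_mul,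
    ← intervalIntegral.integral_const_mul]
  refine intervalIntegral.integral_congr fun φ h => ?_
  rw [uIcc_of_le hpi] at h
  have hc : ((Real.cos (φ / 2) : ℝ) : ℂ) ≠ 0 := by exact_mod_cast cos_half_ne_zero h
  have hss2 : Real.sqrt 2 * s * (1 / 2) = Real.sqrt z := by
    rw [hs, Real.sqrt_mul (by norm_num), ← mul_assoc, Real.mul_self_sqrt (by norm_num)]; ring
  have hph : Complex.exp (-Complex.I * z) * Complex.exp (Complex.I * (z * Real.cos φ - ν * φ : ℝ))
      = Complex.exp (-Complex.I * ((s * Real.sin (φ / 2) : ℝ) : ℂ) ^ 2)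
        * Complex.exp (-Complex.I * ν * φ) := by
    rw [← Complex.exp_add, ← Complex.exp_add]
    congr 1
    have hcos : Real.cos φ = 1 - 2 * Real.sin (φ / 2) ^ 2 := by
      have := Real.cos_two_mul (φ / 2)
      rw [mul_div_cancel₀ _ (by norm_num : (2 : ℝ) ≠ 0)] at this
      nlinarith [Real.sin_sq_add_cos_sq (φ / 2)]
    rw [hcos, ← Complex.ofReal_pow, mul_pow, hss]
    push_cast
    ring
  have : (Real.sqrt z : ℂ) = Real.sqrt 2 * s * (1 / 2) := by rw [← hss2]; push_cast; ring
  simp only [schlafliAmp]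
  rw [mul_assoc, hph, this]
  push_cast at hc ⊢
  field_simp

theorem exists_norm_sqrt_mul_schlafliHalf_le (ν : ℝ) :
    ∃ C : ℝ, ∀ z : ℝ, 0 < z → Real.sqrt z * ‖schlafliHalf ν z‖ ≤ C := by
  set M := ‖fresnelLim‖ + 1
  have hpi : (0 : ℝ) ≤ Real.pi / 2 := by positivity
  refine ⟨Real.sqrt 2 * (M * ‖schlafliAmp ν (Real.pi / 2)‖
    + ∫ φ in (0 : ℝ)..(Real.pi / 2), M * ‖schlafliAmpDeriv ν φ‖), fun z hz => ?_⟩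
  have h := congrArg norm (sqrt_mul_schlafliHalf ν hz)
  have he : ‖Complex.exp (-Complex.I * z)‖ = 1 := by
    rw [Complex.norm_exp]; simp
  simp only [norm_mul, he, mul_one, Complex.norm_real, Real.norm_eq_abs,
    abs_of_nonneg (Real.sqrt_nonneg _)] at h
  rw [h]
  refine mul_le_mul_of_nonneg_left ((norm_sub_le _ _).trans (add_le_add ?_ ?_))
    (Real.sqrt_nonneg _)
  · rw [norm_mul]
    refine mul_le_mul_of_nonneg_right (norm_fresnel_le ?_) (norm_nonneg _)
    exact mul_nonneg (Real.sqrt_nonneg _) (Real.sin_nonneg_of_nonneg_of_le_pi (by positivity)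
      (by linarith [Real.pi_pos]))
  · refine intervalIntegral.norm_integral_le_of_norm_le hpi
      (Eventually.of_forall fun φ hφ => ?_) ?_
    · rw [norm_mul]
      refine mul_le_mul_of_nonneg_right (norm_fresnel_le ?_) (norm_nonneg _)
      exact mul_nonneg (Real.sqrt_nonneg _) (Real.sin_nonneg_of_nonneg_of_le_pi
        (by linarith [hφ.1]) (by linarith [Real.pi_pos, hφ.2]))
    · refine ContinuousOn.intervalIntegrable ?_
      rw [uIcc_of_le hpi]
      exact continuousOn_const.mul (continuousOn_schlafliAmpDeriv ν).norm

theorem tendsto_sqrt_mul_schlafliHalf (ν : ℝ) :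
    Tendsto (fun z : ℝ => (Real.sqrt z : ℂ) * Complex.exp (-Complex.I * z) * schlafliHalf ν z)
      atTop (𝓝 (Real.sqrt 2 * fresnelLim)) := by
  have hpi : (0 : ℝ) ≤ Real.pi / 2 := by positivity
  have hlim : ∀ a : ℝ, 0 < a →
      Tendsto (fun z : ℝ => fresnel (Real.sqrt (2 * z) * a)) atTop (𝓝 fresnelLim) := fun a ha =>
    tendsto_fresnel.comp ((Real.tendsto_sqrt_atTop.comp
      (tendsto_id.const_mul_atTop (by norm_num : (0 : ℝ) < 2))).atTop_mul_const ha)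
  have hInt : IntervalIntegrable (schlafliAmpDeriv ν) volume 0 (Real.pi / 2) :=
    ContinuousOn.intervalIntegrable (by
      rw [uIcc_of_le hpi]; exact continuousOn_schlafliAmpDeriv ν)
  have hd : Tendsto (fun z : ℝ => ∫ φ in (0 : ℝ)..(Real.pi / 2),
      fresnel (Real.sqrt (2 * z) * Real.sin (φ / 2)) * schlafliAmpDeriv ν φ) atTop
      (𝓝 (∫ φ in (0 : ℝ)..(Real.pi / 2), fresnelLim * schlafliAmpDeriv ν φ)) := by
    refine intervalIntegral.tendsto_integral_filter_of_dominated_convergence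
      (fun φ => (‖fresnelLim‖ + 1) * ‖schlafliAmpDeriv ν φ‖) ?_ ?_ (hInt.norm.const_mul _) ?_
    · refine Eventually.of_forall fun z => AEStronglyMeasurable.mul ?_
        (by rw [uIoc_of_le hpi]; exact hInt.1.aestronglyMeasurable)
      have : Continuous fresnel :=
        continuous_iff_continuousAt.2 fun X => (hasDerivAt_fresnel X).continuousAt
      exact (this.comp (by fun_prop)).aestronglyMeasurable
    · refine Eventually.of_forall fun z => Eventually.of_forall fun φ hφ => ?_
      rw [uIoc_of_le hpi] at hφ
      rw [norm_mul]
      refine mul_le_mul_of_nonneg_right (norm_fresnel_le ?_) (norm_nonneg _)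
      exact mul_nonneg (Real.sqrt_nonneg _) (Real.sin_nonneg_of_nonneg_of_le_pi
        (by linarith [hφ.1]) (by linarith [Real.pi_pos, hφ.2]))
    · refine Eventually.of_forall fun φ hφ => ?_
      rw [uIoc_of_le hpi] at hφ
      exact (hlim _ (Real.sin_pos_of_pos_of_lt_pi (by linarith [hφ.1])
        (by linarith [Real.pi_pos, hφ.2]))).mul_const _
  -- In the limit the boundary term and the integral recombine into the amplitude at the stationary
  -- point `φ = 0`, which equals `1`; hence the limit does not depend on `ν`.
  have hftc : ∫ φ in (0 : ℝ)..(Real.pi / 2), schlafliAmpDeriv ν φ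
      = schlafliAmp ν (Real.pi / 2) - 1 := by
    rw [intervalIntegral.integral_eq_sub_of_hasDerivAt (f := schlafliAmp ν) (fun φ h => ?_) hInt]
    · simp [schlafliAmp]
    · rw [uIcc_of_le hpi] at h; exact hasDerivAt_schlafliAmp ν h
  have hmain := (((hlim _ (Real.sin_pos_of_pos_of_lt_pi (x := Real.pi / 4) (by positivity)
    (by linarith [Real.pi_pos]))).mul_const (schlafliAmp ν (Real.pi / 2))).sub hd).const_mul
    (Real.sqrt 2 : ℂ)
  rw [intervalIntegral.integral_const_mul, hftc] at hmain
  have : (Real.sqrt 2 : ℂ) * (fresnelLim * schlafliAmp ν (Real.pi / 2)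
      - fresnelLim * (schlafliAmp ν (Real.pi / 2) - 1)) = Real.sqrt 2 * fresnelLim := by ring
  rw [this] at hmain
  refine hmain.congr' ?_
  filter_upwards [eventually_gt_atTop 0] with z hz
  exact (sqrt_mul_schlafliHalf ν hz).symm

/-! ### The decaying part of the Hankel function -/

/-- From `e^{t/2} ≤ 2 cosh(t/2)` and `sinh t ≥ 2 sinh²(t/2)`, the integrand is dominated by the
derivative of `4 E(sinh(t/2))`, a half-line Gaussian in the variable `sinh(t/2)`. -/
theorem integrableOn_and_integral_exp_half_sub_sinh_le {z : ℝ} (hz : 0 < z) :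
    IntegrableOn (fun t => Real.exp (t / 2) * Real.exp (-z * Real.sinh t)) (Ioi 0) ∧
      ∫ t in Ioi (0 : ℝ), Real.exp (t / 2) * Real.exp (-z * Real.sinh t)
        ≤ 2 * Real.sqrt (Real.pi / (2 * z)) := by
  set E : ℝ → ℝ := fun x => ∫ u in (0 : ℝ)..x, Real.exp (-(2 * z) * u ^ 2) with hE
  have hgi : Integrable fun u : ℝ => Real.exp (-(2 * z) * u ^ 2) :=
    integrable_exp_neg_mul_sq (by positivity)
  have hElim : Tendsto E atTop (𝓝 (Real.sqrt (Real.pi / (2 * z)) / 2)) := by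
    have := intervalIntegral_tendsto_integral_Ioi 0 hgi.integrableOn tendsto_id
    rwa [integral_gaussian_Ioi] at this
  have hsinh : Tendsto (fun t : ℝ => Real.sinh (t / 2)) atTop atTop := by
    refine tendsto_atTop_mono' _ ?_ (tendsto_id.atTop_div_const (by norm_num : (0 : ℝ) < 2))
    filter_upwards [eventually_ge_atTop 0] with t ht
    exact Real.self_le_sinh_iff.2 (div_nonneg ht zero_le_two)
  have hder : ∀ t ∈ Ici (0 : ℝ), HasDerivAt (fun t => 4 * E (Real.sinh (t / 2)))
      (2 * Real.cosh (t / 2) * Real.exp (-(2 * z) * Real.sinh (t / 2) ^ 2)) t := by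
    intro t _
    have hc : Continuous fun u : ℝ => Real.exp (-(2 * z) * u ^ 2) := by fun_prop
    have h1 : HasDerivAt E (Real.exp (-(2 * z) * Real.sinh (t / 2) ^ 2)) (Real.sinh (t / 2)) :=
      intervalIntegral.integral_hasDerivAt_right (hc.intervalIntegrable _ _)
        hc.stronglyMeasurable.stronglyMeasurableAtFilter hc.continuousAt
    have h2 : HasDerivAt (fun t : ℝ => Real.sinh (t / 2)) (Real.cosh (t / 2) * (1 / 2)) t :=
      ((hasDerivAt_id t).div_const 2).sinh
    refine ((h1.comp t h2).const_mul 4).congr_deriv ?_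
    ring
  have hlim := (hElim.comp hsinh).const_mul 4
  have hnn : ∀ t ∈ Ioi (0 : ℝ),
      0 ≤ 2 * Real.cosh (t / 2) * Real.exp (-(2 * z) * Real.sinh (t / 2) ^ 2) := fun t _ => by
    have := Real.cosh_pos (t / 2); positivity
  have hI := integrableOn_Ioi_deriv_of_nonneg' hder hnn hlim
  have hV := integral_Ioi_of_hasDerivAt_of_nonneg' hder hnn hlim
  have hle : ∀ t ∈ Ioi (0 : ℝ), Real.exp (t / 2) * Real.exp (-z * Real.sinh t)
      ≤ 2 * Real.cosh (t / 2) * Real.exp (-(2 * z) * Real.sinh (t / 2) ^ 2) := by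
    intro t ht
    have ht0 : (0 : ℝ) < t := ht
    have hs0 : 0 ≤ Real.sinh (t / 2) := Real.sinh_nonneg_iff.2 (by positivity)
    refine mul_le_mul ?_ (Real.exp_le_exp.2 ?_) (Real.exp_pos _).le
      (by have := Real.cosh_pos (t / 2); positivity)
    · rw [Real.cosh_eq]; linarith [Real.exp_pos (-(t / 2))]
    · have h2 := Real.sinh_two_mul (t / 2)
      rw [mul_div_cancel₀ _ (by norm_num : (2 : ℝ) ≠ 0)] at h2
      have h3 : Real.sinh (t / 2) ≤ Real.cosh (t / 2) := (Real.sinh_lt_cosh _).le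
      rw [h2]
      nlinarith [mul_le_mul_of_nonneg_left h3 (mul_nonneg hz.le hs0)]
  have hm : IntegrableOn (fun t => Real.exp (t / 2) * Real.exp (-z * Real.sinh t)) (Ioi 0) := by
    refine Integrable.mono' hI (Continuous.aestronglyMeasurable (by fun_prop)) ?_
    filter_upwards [ae_restrict_mem measurableSet_Ioi] with t ht
    rw [Real.norm_of_nonneg (by positivity)]
    exact hle t ht
  refine ⟨hm, (setIntegral_mono_on hm hI measurableSet_Ioi hle).trans ?_⟩
  rw [hV]
  simp [hE]
  linarith

/-- For `z ≥ 1`, `t/2 - z sinh t ≤ -zt/2`. The rate `1/z` is needed because `z^{-1/2}` alone would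
not vanish after multiplication by `√z`. -/
theorem integral_exp_half_sub_sinh_le_div {z : ℝ} (hz : 1 ≤ z) :
    ∫ t in Ioi (0 : ℝ), Real.exp (t / 2) * Real.exp (-z * Real.sinh t) ≤ 2 / z := by
  have hz0 : 0 < z := by linarith
  have hneg : -(z / 2) < 0 := by linarith
  refine (setIntegral_mono_on (integrableOn_and_integral_exp_half_sub_sinh_le hz0).1
    (integrableOn_exp_mul_Ioi hneg 0) measurableSet_Ioi fun t ht => ?_).trans ?_
  · have ht0 : (0 : ℝ) < t := ht
    rw [← Real.exp_add]
    refine Real.exp_le_exp.2 ?_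
    have := Real.self_le_sinh_iff.2 ht0.le
    nlinarith [mul_le_mul_of_nonneg_left this hz0.le]
  · rw [integral_exp_mul_Ioi hneg]
    simp only [mul_zero, Real.exp_zero]
    apply le_of_eq
    field_simp

/-- The non-oscillating part of the Schläfli representation of `H_ν^{(1)}`. -/
noncomputable def hankelTail (ν z : ℝ) : ℂ :=
  -((Real.sin (ν * Real.pi) / Real.pi
      * ∫ t in Set.Ioi (0 : ℝ), Real.exp (-z * Real.sinh t - ν * t) : ℝ) : ℂ)
    - Complex.I * ((1 / Real.pi * ∫ t in Set.Ioi (0 : ℝ),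
          (Real.exp (ν * t) + Real.exp (-ν * t) * Real.cos (ν * Real.pi))
            * Real.exp (-z * Real.sinh t) : ℝ) : ℂ)

theorem norm_hankelTail_le {ν : ℝ} (hν : 0 ≤ ν) (hν' : ν ≤ 1 / 2) {z : ℝ} (hz : 0 < z) :
    ‖hankelTail ν z‖ ≤ ∫ t in Ioi (0 : ℝ), Real.exp (t / 2) * Real.exp (-z * Real.sinh t) := by
  set T := ∫ t in Ioi (0 : ℝ), Real.exp (t / 2) * Real.exp (-z * Real.sinh t) with hT
  have hI := (integrableOn_and_integral_exp_half_sub_sinh_le hz).1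
  have hT0 : 0 ≤ T := setIntegral_nonneg measurableSet_Ioi fun t _ => by positivity
  have hA : ‖∫ t in Set.Ioi (0 : ℝ), Real.exp (-z * Real.sinh t - ν * t)‖ ≤ T := by
    refine norm_integral_le_of_norm_le hI ?_
    filter_upwards [ae_restrict_mem measurableSet_Ioi] with t ht
    have ht0 : (0 : ℝ) < t := ht
    rw [Real.norm_of_nonneg (Real.exp_pos _).le, ← Real.exp_add]
    exact Real.exp_le_exp.2 (by nlinarith)
  have hB : ‖∫ t in Set.Ioi (0 : ℝ),
          (Real.exp (ν * t) + Real.exp (-ν * t) * Real.cos (ν * Real.pi))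
            * Real.exp (-z * Real.sinh t)‖ ≤ 2 * T := by
    rw [hT, ← integral_const_mul]
    refine norm_integral_le_of_norm_le (hI.const_mul 2) ?_
    filter_upwards [ae_restrict_mem measurableSet_Ioi] with t ht
    have ht0 : (0 : ℝ) < t := ht
    rw [norm_mul, Real.norm_of_nonneg (Real.exp_pos (-z * Real.sinh t)).le, ← mul_assoc]
    refine mul_le_mul_of_nonneg_right ?_ (Real.exp_pos _).le
    have h1 : Real.exp (ν * t) ≤ Real.exp (t / 2) := Real.exp_le_exp.2 (by nlinarith)
    have h2 : Real.exp (-ν * t) ≤ Real.exp (t / 2) := Real.exp_le_exp.2 (by nlinarith)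
    refine (norm_add_le _ _).trans ?_
    rw [norm_mul, Real.norm_of_nonneg (Real.exp_pos _).le, Real.norm_of_nonneg (Real.exp_pos _).le]
    have h3 : ‖Real.cos (ν * Real.pi)‖ ≤ 1 := Real.abs_cos_le_one _
    nlinarith [mul_le_mul_of_nonneg_left h3 (Real.exp_pos (-ν * t)).le]
  have hs : ‖Real.sin (ν * Real.pi)‖ ≤ 1 := Real.abs_sin_le_one _
  have hpi := Real.pi_gt_three
  refine (norm_sub_le _ _).trans ?_
  rw [norm_neg, norm_mul, Complex.norm_I, one_mul, Complex.norm_real, Complex.norm_real, norm_mul,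
    norm_mul, norm_div, norm_div, norm_one, Real.norm_of_nonneg Real.pi_pos.le]
  -- One copy of `T` comes from `J_ν` and two from `Y_ν`; `3 < π` absorbs them.
  calc _ ≤ 1 / Real.pi * T + 1 / Real.pi * (2 * T) := by gcongr
    _ = 3 * T / Real.pi := by ring
    _ ≤ T := by rw [div_le_iff₀ Real.pi_pos]; nlinarith

/-! ### The Hankel function -/

/-- The phase is stationary at `θ = π/2`. Translating the right half and reflecting the left half
put this point at `φ = 0`, with opposite signs of `ν`. -/
theorem integral_schlafli_eq (ν z : ℝ) :
    ∫ θ in (0 : ℝ)..Real.pi, Complex.exp (Complex.I * (z * Real.sin θ - ν * θ : ℝ))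
      = Complex.exp (-Complex.I * (ν * (Real.pi / 2) : ℝ))
        * (schlafliHalf ν z + schlafliHalf (-ν) z) := by
  have hc : Continuous fun θ : ℝ => Complex.exp (Complex.I * (z * Real.sin θ - ν * θ : ℝ)) := by
    fun_prop
  rw [← intervalIntegral.integral_add_adjacent_intervals (b := Real.pi / 2)
    (hc.intervalIntegrable _ _) (hc.intervalIntegrable _ _), add_comm, mul_add]
  congr 1
  · have h := intervalIntegral.integral_comp_add_right (a := 0) (b := Real.pi / 2)
      (fun θ : ℝ => Complex.exp (Complex.I * (z * Real.sin θ - ν * θ : ℝ))) (Real.pi / 2)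
    rw [zero_add, add_halves] at h
    rw [← h, schlafliHalf, ← intervalIntegral.integral_const_mul]
    refine intervalIntegral.integral_congr fun φ _ => ?_
    rw [← Complex.exp_add, Real.sin_add_pi_div_two]
    congr 1
    push_cast
    ring
  · have h := intervalIntegral.integral_comp_sub_left (a := 0) (b := Real.pi / 2)
      (fun θ : ℝ => Complex.exp (Complex.I * (z * Real.sin θ - ν * θ : ℝ))) (Real.pi / 2)
    rw [sub_zero, sub_self] at h
    rw [← h, schlafliHalf, ← intervalIntegral.integral_const_mul]
    refine intervalIntegral.integral_congr fun φ _ => ?_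
    rw [← Complex.exp_add, Real.sin_pi_div_two_sub]
    congr 1
    push_cast
    ring

theorem hankelH1_eq (ν z : ℝ) :
    hankelH1 ν z = (1 / Real.pi : ℝ) * (Complex.exp (-Complex.I * (ν * (Real.pi / 2) : ℝ))
        * (schlafliHalf ν z + schlafliHalf (-ν) z)) + hankelTail ν z := by
  have hsplit : ∫ θ in (0 : ℝ)..Real.pi, Complex.exp (Complex.I * (z * Real.sin θ - ν * θ : ℝ))
      = ((∫ θ in (0 : ℝ)..Real.pi, Real.cos (z * Real.sin θ - ν * θ) : ℝ) : ℂ)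
        + Complex.I * ((∫ θ in (0 : ℝ)..Real.pi, Real.sin (z * Real.sin θ - ν * θ) : ℝ) : ℂ) := by
    rw [← intervalIntegral.integral_ofReal, ← intervalIntegral.integral_ofReal,
      ← intervalIntegral.integral_const_mul, ← intervalIntegral.integral_add
        (Continuous.intervalIntegrable (by fun_prop) _ _)
        (Continuous.intervalIntegrable (by fun_prop) _ _)]
    refine intervalIntegral.integral_congr fun θ _ => ?_
    rw [mul_comm, Complex.exp_mul_I]
    push_cast
    ring
  rw [← integral_schlafli_eq, hsplit, hankelH1, besselJ, besselY, hankelTail]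
  push_cast
  ring

theorem exists_sqrt_mul_norm_hankelH1_le {ν : ℝ} (hν : 0 ≤ ν) (hν' : ν ≤ 1 / 2) :
    ∃ C : ℝ, ∀ z : ℝ, 0 < z → Real.sqrt z * ‖hankelH1 ν z‖ ≤ C := by
  obtain ⟨C₁, h₁⟩ := exists_norm_sqrt_mul_schlafliHalf_le ν
  obtain ⟨C₂, h₂⟩ := exists_norm_sqrt_mul_schlafliHalf_le (-ν)
  refine ⟨1 / Real.pi * (C₁ + C₂) + 2 * Real.sqrt (Real.pi / 2), fun z hz => ?_⟩
  have ht := (norm_hankelTail_le hν hν' hz).trans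
    (integrableOn_and_integral_exp_half_sub_sinh_le hz).2
  have hsz := Real.sqrt_pos.2 hz
  have he : ‖Complex.exp (-Complex.I * (ν * (Real.pi / 2) : ℝ))‖ = 1 := by
    rw [Complex.norm_exp]; simp
  have hs : Real.sqrt (Real.pi / (2 * z)) * Real.sqrt z = Real.sqrt (Real.pi / 2) := by
    rw [← Real.sqrt_mul (by positivity)]; congr 1; field_simp
  have h3 : ‖hankelH1 ν z‖ ≤ 1 / Real.pi * (‖schlafliHalf ν z‖ + ‖schlafliHalf (-ν) z‖)
      + 2 * Real.sqrt (Real.pi / (2 * z)) := by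
    rw [hankelH1_eq]
    refine (norm_add_le _ _).trans (add_le_add ?_ ht)
    rw [norm_mul, norm_mul, he, one_mul, Complex.norm_real,
      Real.norm_of_nonneg (by positivity : (0 : ℝ) ≤ 1 / Real.pi)]
    gcongr
    exact norm_add_le _ _
  calc _ ≤ Real.sqrt z * _ := mul_le_mul_of_nonneg_left h3 hsz.le
    _ = 1 / Real.pi * (Real.sqrt z * ‖schlafliHalf ν z‖ + Real.sqrt z * ‖schlafliHalf (-ν) z‖)
      + 2 * (Real.sqrt (Real.pi / (2 * z)) * Real.sqrt z) := by ring
    _ ≤ _ := by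
      rw [hs]
      gcongr
      · exact h₁ z hz
      · exact h₂ z hz

theorem tendsto_sqrt_mul_hankelH1 {ν : ℝ} (hν : 0 ≤ ν) (hν' : ν ≤ 1 / 2) :
    Tendsto (fun z : ℝ => (Real.sqrt z : ℂ) * Complex.exp (-Complex.I * z) * hankelH1 ν z) atTop
      (𝓝 ((1 / Real.pi : ℝ) * Complex.exp (-Complex.I * (ν * (Real.pi / 2) : ℝ))
        * (2 * (Real.sqrt 2 * fresnelLim)))) := by
  have h1 := ((tendsto_sqrt_mul_schlafliHalf ν).add
    (tendsto_sqrt_mul_schlafliHalf (-ν))).const_mul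
    (((1 / Real.pi : ℝ) : ℂ) * Complex.exp (-Complex.I * (ν * (Real.pi / 2) : ℝ)))
  have h2 : Tendsto (fun z : ℝ => (Real.sqrt z : ℂ) * Complex.exp (-Complex.I * z)
      * hankelTail ν z) atTop (𝓝 0) := by
    rw [tendsto_zero_iff_norm_tendsto_zero]
    have hlim : Tendsto (fun z : ℝ => 2 * (Real.sqrt z)⁻¹) atTop (𝓝 0) := by
      simpa using (Real.tendsto_sqrt_atTop.inv_tendsto_atTop).const_mul 2
    refine squeeze_zero' (Eventually.of_forall fun _ => norm_nonneg _) ?_ hlim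
    filter_upwards [eventually_ge_atTop 1] with z hz
    have hz0 : 0 < z := by linarith
    have ht := (norm_hankelTail_le hν hν' hz0).trans (integral_exp_half_sub_sinh_le_div hz)
    have he : ‖Complex.exp (-Complex.I * z)‖ = 1 := by
      rw [Complex.norm_exp]; simp
    have hsz := Real.sqrt_pos.2 hz0
    rw [norm_mul, norm_mul, he, mul_one, Complex.norm_real, Real.norm_of_nonneg hsz.le]
    calc _ ≤ Real.sqrt z * (2 / z) := mul_le_mul_of_nonneg_left ht hsz.le
      _ = 2 * (Real.sqrt z)⁻¹ := by
        nth_rewrite 2 [← Real.mul_self_sqrt hz0.le]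
        field_simp
  have h3 := h1.add h2
  rw [add_zero, ← two_mul] at h3
  refine h3.congr fun z => ?_
  rw [hankelH1_eq]
  ring

theorem measurable_hankelH1 (ν : ℝ) : Measurable (hankelH1 ν) := by
  have hset : ∀ F : ℝ → ℝ → ℝ, Continuous (Function.uncurry F) → ∀ s : Set ℝ,
      Measurable fun z => ∫ t in s, F z t := fun F hF s =>
    (StronglyMeasurable.integral_prod_right (ν := volume.restrict s) hF.stronglyMeasurable).measurable
  have hInt : ∀ F : ℝ → ℝ → ℝ, Continuous (Function.uncurry F) →
      Measurable fun z => ∫ t in (0 : ℝ)..Real.pi, F z t := fun F hF => by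
    simp only [intervalIntegral.integral_of_le Real.pi_pos.le]
    exact hset F hF _
  have hJ : Measurable (besselJ ν) :=
    ((hInt (fun z θ => Real.cos (z * Real.sin θ - ν * θ)) (by fun_prop)).const_mul _).sub
      ((hset (fun z t => Real.exp (-z * Real.sinh t - ν * t)) (by fun_prop) _).const_mul _)
  have hY : Measurable (besselY ν) :=
    ((hInt (fun z θ => Real.sin (z * Real.sin θ - ν * θ)) (by fun_prop)).const_mul _).sub
      ((hset (fun z t => (Real.exp (ν * t) + Real.exp (-ν * t) * Real.cos (ν * Real.pi))
            * Real.exp (-z * Real.sinh t)) (by fun_prop) _).const_mul _)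
  exact (Complex.measurable_ofReal.comp hJ).add
    ((Complex.measurable_ofReal.comp hY).const_mul _)

/-! ### The outgoing kernel -/

theorem measurable_greenFn (n : ℕ) (k : ℝ) : Measurable (greenFn n k) := by
  unfold greenFn
  refine Measurable.mul (measurable_const.mul (Complex.measurable_ofReal.comp ?_))
    ((measurable_hankelH1 _).comp (by fun_prop))
  fun_prop

theorem rpow_mul_greenFn_eq (n : ℕ) {k r : ℝ} (hk : 0 < k) (hr : 0 < r) :
    ((r ^ (((n : ℝ) - 1) / 2) : ℝ) : ℂ) * greenFn n k r
      = (Complex.I / 4) * (((k / (2 * Real.pi)) ^ (((n : ℝ) - 2) / 2) * k ^ (-(1 / 2) : ℝ) : ℝ) : ℂ)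
        * ((Real.sqrt (k * r) : ℂ) * hankelH1 (((n : ℝ) - 2) / 2) (k * r)) := by
  have h1 : r ^ (((n : ℝ) - 1) / 2) = r ^ (((n : ℝ) - 2) / 2) * r ^ (1 / 2 : ℝ) := by
    rw [← Real.rpow_add hr]; congr 1; ring
  have h2 : (k / (2 * Real.pi * r)) ^ (((n : ℝ) - 2) / 2) * r ^ (((n : ℝ) - 2) / 2)
      = (k / (2 * Real.pi)) ^ (((n : ℝ) - 2) / 2) := by
    rw [← Real.mul_rpow (by positivity) hr.le]; congr 1; field_simp
  have h3 : k ^ (-(1 / 2) : ℝ) * Real.sqrt (k * r) = r ^ (1 / 2 : ℝ) := by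
    rw [Real.sqrt_eq_rpow, Real.mul_rpow hk.le hr.le, ← mul_assoc, ← Real.rpow_add hk]
    simp
  rw [← h2, h1, greenFn, ← h3]
  push_cast
  ring

/-- The bound covers small `r` as well: `r^{-(n-1)/2}` is the true singularity for `n = 3` and
dominates the logarithm for `n = 2`. Both orders `(n-2)/2` lie in `[0, 1/2]`, as the tail estimate
requires. -/
theorem exists_rpow_mul_norm_greenFn_le {n : ℕ} (hn : n = 2 ∨ n = 3) {k : ℝ} (hk : 0 < k) :
    ∃ C : ℝ, 0 ≤ C ∧ ∀ r : ℝ, 0 < r → r ^ (((n : ℝ) - 1) / 2) * ‖greenFn n k r‖ ≤ C := by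
  have hν : (0 : ℝ) ≤ ((n : ℝ) - 2) / 2 := by rcases hn with rfl | rfl <;> norm_num
  have hν' : ((n : ℝ) - 2) / 2 ≤ 1 / 2 := by rcases hn with rfl | rfl <;> norm_num
  obtain ⟨C, hC⟩ := exists_sqrt_mul_norm_hankelH1_le hν hν'
  obtain ⟨A, hA⟩ : ∃ A, A = (Complex.I / 4)
    * (((k / (2 * Real.pi)) ^ (((n : ℝ) - 2) / 2) * k ^ (-(1 / 2) : ℝ) : ℝ) : ℂ) := ⟨_, rfl⟩
  have hbd : ∀ r : ℝ, 0 < r → r ^ (((n : ℝ) - 1) / 2) * ‖greenFn n k r‖ ≤ ‖A‖ * C := by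
    intro r hr
    have h := congrArg norm (rpow_mul_greenFn_eq n hk hr)
    rw [← hA, norm_mul, Complex.norm_real, Real.norm_of_nonneg (by positivity), norm_mul A,
      norm_mul, Complex.norm_real, Real.norm_of_nonneg (Real.sqrt_nonneg _)] at h
    rw [h]
    exact mul_le_mul_of_nonneg_left (hC _ (by positivity)) (norm_nonneg _)
  exact ⟨‖A‖ * C, le_trans (by positivity) (hbd 1 one_pos), hbd⟩

theorem farFieldConst_eq (n : ℕ) {k : ℝ} (hk : 0 < k) :
    (Complex.I / 4) * (((k / (2 * Real.pi)) ^ (((n : ℝ) - 2) / 2) * k ^ (-(1 / 2) : ℝ) : ℝ) : ℂ)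
        * ((1 / Real.pi : ℝ)
          * Complex.exp (-Complex.I * (((n : ℝ) - 2) / 2 * (Real.pi / 2) : ℝ))
          * (2 * (Real.sqrt 2 * fresnelLim)))
      = farFieldConst n * ((k ^ (((n : ℝ) - 3) / 2) : ℝ) : ℂ) := by
  have hpi := Real.pi_pos
  have hk1 : (k / (2 * Real.pi)) ^ (((n : ℝ) - 2) / 2) * k ^ (-(1 / 2) : ℝ)
      = k ^ (((n : ℝ) - 3) / 2) / (2 * Real.pi) ^ (((n : ℝ) - 2) / 2) := by
    rw [Real.div_rpow hk.le (by positivity), div_mul_eq_mul_div, ← Real.rpow_add hk]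
    congr 2; ring
  have hp1 : (2 * Real.pi) ^ (((n : ℝ) - 1) / 2)
      = (2 * Real.pi) ^ (((n : ℝ) - 2) / 2) * (Real.sqrt 2 * Real.sqrt Real.pi) := by
    rw [← Real.sqrt_mul (by norm_num), Real.sqrt_eq_rpow, ← Real.rpow_add (by positivity)]
    congr 1; ring
  -- The angles add up to `π/2 - (n-2)π/4 - π/4 = -(n-3)π/4`.
  have hphase : Complex.I * Complex.exp (-Complex.I * (((n : ℝ) - 2) / 2 * (Real.pi / 2) : ℝ))
      * Complex.exp (-(Real.pi / 4 : ℝ) * Complex.I)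
      = Complex.exp (-(Complex.I * (Real.pi : ℂ) * (((n : ℂ) - 3) / 4))) := by
    have hI : Complex.I = Complex.exp (Real.pi / 2 * Complex.I) := Complex.exp_pi_div_two_mul_I.symm
    nth_rewrite 1 [hI]
    rw [← Complex.exp_add, ← Complex.exp_add]
    congr 1
    push_cast
    ring
  have hX : ((2 * Real.pi) ^ (((n : ℝ) - 2) / 2) : ℝ) ≠ 0 := by positivity
  have h2 : ((Real.sqrt 2 : ℝ) : ℂ) ^ 2 = 2 := by
    rw [← Complex.ofReal_pow, Real.sq_sqrt (by norm_num)]; norm_num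
  have h3 : ((Real.sqrt Real.pi : ℝ) : ℂ) ^ 2 = Real.pi := by
    rw [← Complex.ofReal_pow, Real.sq_sqrt hpi.le]
  have hs2 : ((Real.sqrt 2 : ℝ) : ℂ) ≠ 0 := by
    exact_mod_cast (Real.sqrt_pos.2 (by norm_num : (0 : ℝ) < 2)).ne'
  have hsp : ((Real.sqrt Real.pi : ℝ) : ℂ) ≠ 0 := by exact_mod_cast (Real.sqrt_pos.2 hpi).ne'
  have hpc : (Real.pi : ℂ) ≠ 0 := by exact_mod_cast hpi.ne'
  rw [farFieldConst, ← hphase, hp1, hk1, fresnelLim]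
  generalize (2 * Real.pi) ^ (((n : ℝ) - 2) / 2) = X at hX
  generalize k ^ (((n : ℝ) - 3) / 2) = Y
  generalize Complex.exp (-Complex.I * (((n : ℝ) - 2) / 2 * (Real.pi / 2) : ℝ)) = e₁
  generalize Complex.exp (-(Real.pi / 4 : ℝ) * Complex.I) = e₂
  have hXc : (X : ℂ) ≠ 0 := by exact_mod_cast hX
  push_cast
  rw [← h3]
  field_simp
  rw [h2]
  ring

theorem tendsto_rpow_mul_greenFn {n : ℕ} (hn : n = 2 ∨ n = 3) {k : ℝ} (hk : 0 < k) :
    Tendsto (fun r : ℝ => ((r ^ (((n : ℝ) - 1) / 2) : ℝ) : ℂ)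
        * Complex.exp (-Complex.I * (k * r : ℝ)) * greenFn n k r) atTop
      (𝓝 (farFieldConst n * ((k ^ (((n : ℝ) - 3) / 2) : ℝ) : ℂ))) := by
  have hν : (0 : ℝ) ≤ ((n : ℝ) - 2) / 2 := by rcases hn with rfl | rfl <;> norm_num
  have hν' : ((n : ℝ) - 2) / 2 ≤ 1 / 2 := by rcases hn with rfl | rfl <;> norm_num
  have h := (((tendsto_sqrt_mul_hankelH1 hν hν').comp (tendsto_id.const_mul_atTop hk)).const_mul
    ((Complex.I / 4)
      * (((k / (2 * Real.pi)) ^ (((n : ℝ) - 2) / 2) * k ^ (-(1 / 2) : ℝ) : ℝ) : ℂ)))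
  rw [farFieldConst_eq n hk] at h
  refine h.congr' ?_
  filter_upwards [eventually_gt_atTop 0] with r hr
  rw [mul_right_comm (((r ^ (((n : ℝ) - 1) / 2) : ℝ) : ℂ)), rpow_mul_greenFn_eq n hk hr]
  simp only [Function.comp_apply, id]
  ring

open scoped Convolution
open ContinuousLinearMap (lsmul)

variable {n : ℕ}

/-! ### Mollification in `L²` -/

/-- This is an `L²` inner product against a translate of `h`, and translations act continuously on
`L²`. -/
theorem continuous_integral_mul_translate {G h : Rn n → ℝ} (hG : MemLp G 2 volume)
    (hh : MemLp h 2 volume) : Continuous fun t : Rn n => ∫ x, G x * h (t + x) := by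
  have : Fact ((2 : ℝ≥0∞) ≠ ⊤) := ⟨by norm_num⟩
  have hc : Continuous fun t : Rn n =>
      inner ℝ (hG.toLp G) (DomAddAct.mk t +ᵥ hh.toLp h) :=
    continuous_const.inner (DomAddAct.continuous_mk.vadd continuous_const)
  refine hc.congr fun t => ?_
  rw [DomAddAct.mk_vadd_toLp, L2.inner_def]
  refine integral_congr_ae ?_
  filter_upwards [hG.coeFn_toLp, MemLp.coeFn_toLp
    (hh.comp_measurePreserving (measurePreserving_vadd t (volume : Measure (Rn n))))] with x h1 h2
  rw [h1]
  erw [h2]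
  simp [mul_comm]

theorem integral_mul_mollify_eq {G h : Rn n → ℝ} (hG : MemLp G 2 volume)
    (hh : MemLp h 2 volume) (b : ContDiffBump (0 : Rn n)) :
    ∫ x, G x * (b.normed volume ⋆[lsmul ℝ ℝ, volume] h) x
      = (b.normed volume ⋆[lsmul ℝ ℝ, volume] fun t => ∫ x, G x * h (t + x)) 0 := by
  set ρ := b.normed (volume : Measure (Rn n)) with hρ
  have hρi : Integrable ρ := b.integrable_normed
  have hρ0 : ∀ x, 0 ≤ ρ x := b.nonneg_normed
  simp only [convolution_def, ContinuousLinearMap.lsmul_apply, smul_eq_mul,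
    ← integral_const_mul]
  have hInt : Integrable (Function.uncurry fun x t : Rn n => G x * (ρ t * h (x - t)))
      (volume.prod volume) := by
    have hm : AEStronglyMeasurable (Function.uncurry fun x t : Rn n => G x * (ρ t * h (x - t)))
        (volume.prod volume) :=
      hG.1.comp_fst.mul
        (hρi.aestronglyMeasurable.convolution_integrand (lsmul ℝ ℝ) hh.1)
    -- Fubini is justified by `|G ρ h| ≤ ρ G² + ρ h²`, where both terms are integrable on the
    -- product.
    have h1 : Integrable (fun p : Rn n × Rn n => G p.1 ^ 2 * ρ p.2) (volume.prod volume) :=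
      hG.integrable_sq.mul_prod hρi
    have h2 : Integrable (fun p : Rn n × Rn n => ρ p.2 * h (p.1 - p.2) ^ 2)
        (volume.prod volume) := hρi.convolution_integrand (lsmul ℝ ℝ) hh.integrable_sq
    refine (h1.add h2).mono' hm (Eventually.of_forall fun p => ?_)
    simp only [Function.uncurry, Pi.add_apply]
    rw [Real.norm_eq_abs, abs_le]
    have := hρ0 p.2
    constructor
    · nlinarith [mul_nonneg this (sq_nonneg (G p.1 + h (p.1 - p.2))),
        mul_nonneg this (sq_nonneg (G p.1)), mul_nonneg this (sq_nonneg (h (p.1 - p.2)))]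
    · nlinarith [mul_nonneg this (sq_nonneg (G p.1 - h (p.1 - p.2))),
        mul_nonneg this (sq_nonneg (G p.1)), mul_nonneg this (sq_nonneg (h (p.1 - p.2)))]
  rw [integral_integral_swap hInt]
  refine integral_congr_ae (Eventually.of_forall fun t => integral_congr_ae
    (Eventually.of_forall fun x => ?_))
  simp only [zero_sub, neg_add_eq_sub]
  ring

/-- `f` is square integrable on bounded sets. -/
def LocL2 {F : Type*} [NormedAddCommGroup F] (f : Rn n → F) : Prop :=
  ∀ R : ℝ, MemLp f 2 (volume.restrict (Metric.closedBall 0 R))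

/-- Weak convergence of mollifications is enough for the product rule. Once the bump radius is below
`1`, only values of `h` in the ball of radius `R + 1` are seen, so `h` may be truncated to a global
`L²` function; the pairing is then an approximate identity applied at `0` to a continuous function.
-/
theorem tendsto_integral_mul_mollify {G h : Rn n → ℝ} (hG : MemLp G 2 volume) {R : ℝ}
    (hGR : ∀ x, R < ‖x‖ → G x = 0) (hh : LocL2 h) {b : ℕ → ContDiffBump (0 : Rn n)}
    (hb : Tendsto (fun m => (b m).rOut) atTop (𝓝 0)) :
    Tendsto (fun m => ∫ x, G x * ((b m).normed volume ⋆[lsmul ℝ ℝ, volume] h) x) atTop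
      (𝓝 (∫ x, G x * h x)) := by
  set B : Set (Rn n) := Metric.closedBall 0 (R + 1)
  have hBm : MeasurableSet B := Metric.isClosed_closedBall.measurableSet
  set h' := B.indicator h with hh'
  have hh'2 : MemLp h' 2 volume := (memLp_indicator_iff_restrict hBm).2 (hh _)
  have hc := continuous_integral_mul_translate hG hh'2
  have hlim := ContDiffBump.convolution_tendsto_right_of_continuous (μ := volume) hb hc 0
  simp only [zero_add] at hlim
  have e0 : ∫ x, G x * h' x = ∫ x, G x * h x := by
    refine integral_congr_ae (Eventually.of_forall fun x => ?_)
    by_cases hx : R < ‖x‖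
    · simp [hGR x hx]
    · have : x ∈ B := by simp only [B, mem_closedBall_zero_iff]; linarith
      simp [hh', this]
  rw [e0] at hlim
  refine hlim.congr' ?_
  filter_upwards [hb.eventually (gt_mem_nhds zero_lt_one)] with m hm
  rw [← integral_mul_mollify_eq hG hh'2]
  refine integral_congr_ae (Eventually.of_forall fun x => ?_)
  by_cases hx : R < ‖x‖
  · simp [hGR x hx]
  · simp only [convolution_def]
    congr 1
    refine integral_congr_ae (Eventually.of_forall fun t => ?_)
    by_cases ht : t ∈ Metric.ball (0 : Rn n) (b m).rOut
    · have : x - t ∈ B := by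
        simp only [B, mem_closedBall_zero_iff]
        rw [mem_ball_zero_iff] at ht
        linarith [norm_sub_le x t]
      simp [hh', this]
    · have : (b m).normed volume t = 0 := by
        rw [← (b m).support_normed_eq (μ := volume)] at ht
        simpa using ht
      simp [this]

theorem isFiniteMeasure_restrict_closedBall (R : ℝ) :
    IsFiniteMeasure (volume.restrict (Metric.closedBall (0 : Rn n) R)) :=
  ⟨by rw [Measure.restrict_apply_univ]; exact (isCompact_closedBall _ _).measure_lt_top⟩

theorem LocL2.locallyIntegrable {F : Type*} [NormedAddCommGroup F] {f : Rn n → F}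
    (hf : LocL2 f) : LocallyIntegrable f volume := by
  intro x
  have := isFiniteMeasure_restrict_closedBall (n := n) (‖x‖ + 1)
  refine ⟨Metric.closedBall 0 (‖x‖ + 1), ?_, (hf _).integrable (by norm_num)⟩
  refine mem_of_superset (Metric.ball_mem_nhds x one_pos) fun y hy => ?_
  rw [mem_closedBall_zero_iff]
  rw [mem_ball_iff_norm] at hy
  linarith [norm_sub_norm_le y x]

theorem memLp_mul_of_locL2 {φ w : Rn n → ℝ} (hφ : Continuous φ) {R : ℝ}
    (hφR : ∀ x, R < ‖x‖ → φ x = 0) (hw : LocL2 w) : MemLp (fun x => φ x * w x) 2 volume := by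
  have hBm : MeasurableSet (Metric.closedBall (0 : Rn n) R) :=
    Metric.isClosed_closedBall.measurableSet
  have he : (fun x => φ x * w x) = (Metric.closedBall (0 : Rn n) R).indicator
      fun x => φ x * w x := by
    symm
    refine indicator_eq_self.2 fun x hx => ?_
    by_contra hc
    rw [mem_closedBall_zero_iff, not_le] at hc
    exact hx (by simp [hφR x hc])
  rw [he, memLp_indicator_iff_restrict hBm]
  obtain ⟨C, hC⟩ := (isCompact_closedBall (0 : Rn n) R).exists_bound_of_continuousOn
    hφ.continuousOn
  refine (hw R).of_le_mul (c := C) (hφ.aestronglyMeasurable.mul (hw R).1) ?_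
  filter_upwards [ae_restrict_mem hBm] with x hx
  rw [norm_mul]
  exact mul_le_mul_of_nonneg_right (hC x hx) (norm_nonneg _)

theorem integrable_mul_of_locL2 {G h : Rn n → ℝ} (hG : MemLp G 2 volume) {R : ℝ}
    (hGR : ∀ x, R < ‖x‖ → G x = 0) (hh : LocL2 h) : Integrable fun x => G x * h x := by
  have hBm : MeasurableSet (Metric.closedBall (0 : Rn n) R) :=
    Metric.isClosed_closedBall.measurableSet
  have he : (fun x => G x * h x) = (Metric.closedBall (0 : Rn n) R).indicator
      fun x => G x * h x := by
    symm
    refine indicator_eq_self.2 fun x hx => ?_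
    by_contra hc
    rw [mem_closedBall_zero_iff, not_le] at hc
    exact hx (by simp [hGR x hc])
  rw [he, integrable_indicator_iff hBm]
  exact (hG.restrict _).integrable_mul (hh R)

theorem _root_.Continuous.locL2 {h : Rn n → ℝ} (hh : Continuous h) : LocL2 h := by
  intro R
  obtain ⟨C, hC⟩ := (isCompact_closedBall (0 : Rn n) R).exists_bound_of_continuousOn
    hh.continuousOn
  have := isFiniteMeasure_restrict_closedBall (n := n) R
  refine MemLp.of_bound hh.aestronglyMeasurable C ?_
  filter_upwards [ae_restrict_mem Metric.isClosed_closedBall.measurableSet] with x hx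
  exact hC x hx

/-! ### The product rule for the weak divergence -/

theorem pderiv_mul {φ ψ : Rn n → ℝ} {x : Rn n} (hφ : DifferentiableAt ℝ φ x)
    (hψ : DifferentiableAt ℝ ψ x) (i : Fin n) :
    pderiv i (fun y => φ y * ψ y) x = pderiv i φ x * ψ x + φ x * pderiv i ψ x := by
  simp only [pderiv]
  rw [fderiv_fun_mul hφ hψ]
  simp
  ring

/-- The derivative falls on the bump `ρ`, and `s ↦ ρ (x - s)` is itself a test function for the weak
derivative; the reflection supplies the cancelling sign. -/
theorem pderiv_mollify {u : Rn n → ℝ} {g : Rn n → ℝ} (hu : LocallyIntegrable u volume) (i : Fin n)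
    (hug : ∀ ψ : Rn n → ℝ, IsTestFn ψ → ∫ x, pderiv i ψ x * u x = -∫ x, ψ x * g x)
    (b : ContDiffBump (0 : Rn n)) (x : Rn n) :
    pderiv i (b.normed volume ⋆[lsmul ℝ ℝ, volume] u) x
      = (b.normed volume ⋆[lsmul ℝ ℝ, volume] g) x := by
  set ρ := b.normed (volume : Measure (Rn n)) with hρ
  have hρc : HasCompactSupport ρ := b.hasCompactSupport_normed
  have hρd : ContDiff ℝ ∞ ρ := b.contDiff_normed
  have hρ1 : ContDiff ℝ 1 ρ := hρd.of_le (by exact_mod_cast le_top)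
  have hd := (hρc.hasFDerivAt_convolution_left (lsmul ℝ ℝ) hρ1 hu x).fderiv
  have hex := (hρc.fderiv (𝕜 := ℝ)).convolutionExists_left ((lsmul ℝ ℝ).precompL (Rn n))
    (hρ1.continuous_fderiv one_ne_zero) hu x
  set ψ : Rn n → ℝ := fun s => ρ (x - s) with hψ
  have hψt : IsTestFn ψ := by
    refine ⟨hρd.comp (contDiff_const.sub contDiff_id), ?_⟩
    exact hρc.comp_homeomorph (Homeomorph.subLeft x)
  have hψd : ∀ s, pderiv i ψ s = -(fderiv ℝ ρ (x - s) (EuclideanSpace.single i 1)) := by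
    intro s
    have h1 : HasFDerivAt (fun s : Rn n => x - s) (-ContinuousLinearMap.id ℝ (Rn n)) s :=
      (hasFDerivAt_id s).const_sub x
    have h2 := ((hρ1.differentiable one_ne_zero) (x - s)).hasFDerivAt.comp s h1
    have h3 : fderiv ℝ ψ s = _ := h2.fderiv
    rw [pderiv, h3]
    simp
  have h := hug ψ hψt
  rw [pderiv, hd, convolution_def, ContinuousLinearMap.integral_apply hex]
  rw [convolution_eq_swap (lsmul ℝ ℝ)]
  simp only [ContinuousLinearMap.precompL_apply, ContinuousLinearMap.lsmul_apply, smul_eq_mul]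
  rw [← integral_sub_left_eq_self (fun t => (fderiv ℝ ρ t) (EuclideanSpace.single i 1) * u (x - t))
    volume x]
  simp only [sub_sub_cancel]
  simp only [hψd, neg_mul] at h
  rw [integral_neg, neg_inj] at h
  exact h

theorem IsTestFn.exists_radius {φ : Rn n → ℝ} (hφ : IsTestFn φ) :
    ∃ R : ℝ, ∀ x, R < ‖x‖ → φ x = 0 ∧ ∀ i, pderiv i φ x = 0 := by
  obtain ⟨R, hR⟩ := hφ.2.isBounded.subset_closedBall (0 : Rn n)
  refine ⟨R, fun x hx => ?_⟩
  have hxt : x ∉ tsupport φ := fun h => by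
    have := hR h
    rw [mem_closedBall_zero_iff] at this
    linarith
  refine ⟨image_eq_zero_of_notMem_tsupport hxt, fun i => ?_⟩
  have : x ∉ Function.support (fderiv ℝ φ) := fun h => hxt (support_fderiv_subset ℝ h)
  rw [Function.notMem_support] at this
  simp [pderiv, this]

theorem IsTestFn.continuous_pderiv {φ : Rn n → ℝ} (hφ : IsTestFn φ) (i : Fin n) :
    Continuous (pderiv i φ) :=
  (hφ.1.continuous_fderiv (by simp)).clm_apply continuous_const

/-- Weak product rule for a real function, all factors being locally square integrable. -/
theorem integral_pderiv_mul_eq {W : Rn n → Rn n} {d : Rn n → ℝ} (hW : LocL2 W) (hd : LocL2 d)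
    (hdiv : IsWeakDiv (𝕜 := ℝ) W d) {u : Rn n → ℝ} {g : Fin n → Rn n → ℝ} (hu : LocL2 u)
    (hg : ∀ i, LocL2 (g i))
    (hug : ∀ ψ : Rn n → ℝ, IsTestFn ψ → ∀ i, ∫ x, pderiv i ψ x * u x = -∫ x, ψ x * g i x)
    {φ : Rn n → ℝ} (hφ : IsTestFn φ) :
    ∫ x, ∑ i, pderiv i φ x * (W x i * u x)
      = -∫ x, φ x * (d x * u x + ∑ i, W x i * g i x) := by
  obtain ⟨R, hR⟩ := hφ.exists_radius
  have hWi : ∀ i, LocL2 fun x => W x i := fun i r =>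
    (hW r).of_le ((EuclideanSpace.proj i).continuous.comp_aestronglyMeasurable (hW r).1)
      (Eventually.of_forall fun x => PiLp.norm_apply_le _ _)
  have hG1 : ∀ i, MemLp (fun x => pderiv i φ x * W x i) 2 volume := fun i =>
    memLp_mul_of_locL2 (hφ.continuous_pderiv i) (fun x hx => (hR x hx).2 i) (hWi i)
  have hG2 : ∀ i, MemLp (fun x => φ x * W x i) 2 volume := fun i =>
    memLp_mul_of_locL2 hφ.1.continuous (fun x hx => (hR x hx).1) (hWi i)
  have hG3 : MemLp (fun x => φ x * d x) 2 volume :=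
    memLp_mul_of_locL2 hφ.1.continuous (fun x hx => (hR x hx).1) hd
  have hz1 : ∀ i x, R < ‖x‖ → pderiv i φ x * W x i = 0 := fun i x hx => by
    rw [(hR x hx).2 i, zero_mul]
  have hz2 : ∀ i x, R < ‖x‖ → φ x * W x i = 0 := fun i x hx => by rw [(hR x hx).1, zero_mul]
  have hz3 : ∀ x, R < ‖x‖ → φ x * d x = 0 := fun x hx => by rw [(hR x hx).1, zero_mul]
  -- Regrouping of the divergence identity tested against `φ v`, with `q` in the role of `∇v`, so
  -- that a fixed compactly supported `L²` factor faces each of `v` and `q`.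
  have key : ∀ v : Rn n → ℝ, ∀ q : Fin n → Rn n → ℝ, LocL2 v → (∀ i, LocL2 (q i)) →
      (∫ x, ∑ i, (pderiv i φ x * v x + φ x * q i x) * W x i) + ∫ x, φ x * v x * d x
      = ((∑ i, ∫ x, pderiv i φ x * W x i * v x) + ∑ i, ∫ x, φ x * W x i * q i x)
        + ∫ x, φ x * d x * v x := by
    intro v q hv hq
    have i1 := fun i => integrable_mul_of_locL2 (hG1 i) (hz1 i) hv
    have i2 := fun i => integrable_mul_of_locL2 (hG2 i) (hz2 i) (hq i)
    rw [← integral_finsetSum _ fun i _ => i1 i, ← integral_finsetSum _ fun i _ => i2 i,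
      ← integral_add (integrable_finsetSum _ fun i _ => i1 i)
        (integrable_finsetSum _ fun i _ => i2 i)]
    congr 1
    · refine integral_congr_ae (Eventually.of_forall fun x => ?_)
      simp only [← Finset.sum_add_distrib]
      exact Finset.sum_congr rfl fun i _ => by ring
    · exact integral_congr_ae (Eventually.of_forall fun x => by ring)
  let b : ℕ → ContDiffBump (0 : Rn n) := fun m =>
    ⟨1 / ((m : ℝ) + 1) / 2, 1 / ((m : ℝ) + 1), by positivity, half_lt_self (by positivity)⟩
  have hb : Tendsto (fun m => (b m).rOut) atTop (𝓝 0) := tendsto_one_div_add_atTop_nhds_zero_nat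
  have hsm : ∀ m (w : Rn n → ℝ), LocL2 w →
      ContDiff ℝ ∞ ((b m).normed volume ⋆[lsmul ℝ ℝ, volume] w) := fun m w hw =>
    (b m).hasCompactSupport_normed.contDiff_convolution_left (lsmul ℝ ℝ) (b m).contDiff_normed
      hw.locallyIntegrable
  have hzero : ∀ m, ((∑ i, ∫ x, pderiv i φ x * W x i
          * ((b m).normed volume ⋆[lsmul ℝ ℝ, volume] u) x)
        + ∑ i, ∫ x, φ x * W x i * ((b m).normed volume ⋆[lsmul ℝ ℝ, volume] g i) x)
        + ∫ x, φ x * d x * ((b m).normed volume ⋆[lsmul ℝ ℝ, volume] u) x = 0 := by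
    intro m
    have hum := hsm m u hu
    rw [← key _ _ hum.continuous.locL2 fun i => (hsm m (g i) (hg i)).continuous.locL2]
    -- After mollification `φ` times `u` is smooth with compact support, so the definition of the
    -- weak divergence of `W` applies to it directly.
    have ht : IsTestFn fun x => φ x * ((b m).normed volume ⋆[lsmul ℝ ℝ, volume] u) x :=
      ⟨hφ.1.mul hum, hφ.2.mul_right⟩
    have h := hdiv.2.2 _ ht
    simp only [smul_eq_mul] at h
    rw [eq_neg_iff_add_eq_zero] at h
    rw [← h]
    congr 1
    refine integral_congr_ae (Eventually.of_forall fun x => Finset.sum_congr rfl fun i _ => ?_)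
    beta_reduce
    rw [pderiv_mul (hφ.1.differentiable (by simp) x) (hum.differentiable (by simp) x),
      pderiv_mollify hu.locallyIntegrable i (fun ψ hψ => hug ψ hψ i)]
  have hlim := (((tendsto_finsetSum Finset.univ fun i _ =>
      tendsto_integral_mul_mollify (hG1 i) (hz1 i) hu hb).add
    (tendsto_finsetSum Finset.univ fun i _ =>
      tendsto_integral_mul_mollify (hG2 i) (hz2 i) (hg i) hb)).add
    (tendsto_integral_mul_mollify hG3 hz3 hu hb))
  simp only [hzero] at hlim
  have hfin := tendsto_nhds_unique tendsto_const_nhds hlim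
  have i1 := fun i => integrable_mul_of_locL2 (hG1 i) (hz1 i) hu
  have i2 := fun i => integrable_mul_of_locL2 (hG2 i) (hz2 i) (hg i)
  have i3 := integrable_mul_of_locL2 hG3 hz3 hu
  rw [← integral_finsetSum _ fun i _ => i1 i, ← integral_finsetSum _ fun i _ => i2 i,
    add_assoc, ← integral_add (integrable_finsetSum _ fun i _ => i2 i) i3] at hfin
  rw [eq_neg_iff_add_eq_zero, hfin]
  congr 1
  · refine integral_congr_ae (Eventually.of_forall fun x => Finset.sum_congr rfl fun i _ => ?_)
    ring
  · refine integral_congr_ae (Eventually.of_forall fun x => ?_)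
    simp only [mul_add, Finset.mul_sum, add_comm (φ x * (d x * u x))]
    congr 1
    · exact Finset.sum_congr rfl fun i _ => by ring
    · ring

theorem _root_.MeasureTheory.LocallyIntegrable.euclidean_apply {𝕜 : Type} [RCLike 𝕜]
    {F : Rn n → Vec 𝕜 n} (hF : LocallyIntegrable F volume) (i : Fin n) :
    LocallyIntegrable (fun x => F x i) volume := fun x => by
  obtain ⟨s, hs, hi⟩ := hF x
  exact ⟨s, hs, (EuclideanSpace.proj (𝕜 := 𝕜) i).integrable_comp hi⟩

theorem LocL2.euclidean_apply {𝕜 : Type} [RCLike 𝕜] {F : Rn n → Vec 𝕜 n} (hF : LocL2 F)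
    (i : Fin n) : LocL2 fun x => F x i := fun r =>
  (hF r).of_le ((EuclideanSpace.proj (𝕜 := 𝕜) i).continuous.comp_aestronglyMeasurable (hF r).1)
    (Eventually.of_forall fun _ => PiLp.norm_apply_le _ _)

/-! ### Uniqueness of weak derivatives -/

theorem IsWeakDiv.ae_eq {F : Rn n → Vec ℂ n} {d₁ d₂ : Rn n → ℂ} (h₁ : IsWeakDiv F d₁)
    (h₂ : IsWeakDiv F d₂) : d₁ =ᵐ[volume] d₂ :=
  ae_eq_of_integral_contDiff_smul_eq h₁.2.1 h₂.2.1 fun φ hφ hc =>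
    neg_injective ((h₁.2.2 φ ⟨hφ, hc⟩).symm.trans (h₂.2.2 φ ⟨hφ, hc⟩))

theorem IsWeakGrad.ae_eq {f : Rn n → ℂ} {g₁ g₂ : Rn n → Vec ℂ n} (h₁ : IsWeakGrad f g₁)
    (h₂ : IsWeakGrad f g₂) : g₁ =ᵐ[volume] g₂ := by
  have h : ∀ i, ∀ᵐ x, g₁ x i = g₂ x i := fun i =>
    ae_eq_of_integral_contDiff_smul_eq (h₁.2.1.euclidean_apply i) (h₂.2.1.euclidean_apply i)
      fun φ hφ hc => neg_injective ((h₁.2.2 φ ⟨hφ, hc⟩ i).symm.trans (h₂.2.2 φ ⟨hφ, hc⟩ i))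
  filter_upwards [ae_all_iff.2 h] with x hx
  ext i
  exact hx i

theorem IsWeakDiv.weakDiv_ae_eq {F : Rn n → Vec ℂ n} {d : Rn n → ℂ} (h : IsWeakDiv F d) :
    weakDiv F =ᵐ[volume] d := by
  have hex : ∃ d, IsWeakDiv F d := ⟨d, h⟩
  rw [weakDiv, dif_pos hex]
  exact hex.choose_spec.ae_eq h

theorem IsWeakGrad.weakGrad_ae_eq {f : Rn n → ℂ} {g : Rn n → Vec ℂ n} (h : IsWeakGrad f g) :
    weakGrad f =ᵐ[volume] g := by
  have hex : ∃ g, IsWeakGrad f g := ⟨g, h⟩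
  rw [weakGrad, dif_pos hex]
  exact hex.choose_spec.ae_eq h

/-! ### The weak divergence of `W f` -/

theorem LocL2.locallyIntegrable_of_norm_le {E F G : Type*} [NormedAddCommGroup E]
    [NormedAddCommGroup F] [NormedAddCommGroup G] {a : Rn n → E} {b : Rn n → F} {c : Rn n → G}
    (ha : LocL2 a) (hb : LocL2 b) (hc : AEStronglyMeasurable c volume)
    (h : ∀ x, ‖c x‖ ≤ ‖a x‖ * ‖b x‖) : LocallyIntegrable c volume := by
  intro x
  refine ⟨Metric.closedBall 0 (‖x‖ + 1), ?_, ?_⟩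
  · refine mem_of_superset (Metric.ball_mem_nhds x one_pos) fun y hy => ?_
    rw [mem_closedBall_zero_iff]
    rw [mem_ball_iff_norm] at hy
    linarith [norm_sub_norm_le y x]
  · exact ((ha _).norm.integrable_mul (hb _).norm).mono' hc.restrict (Eventually.of_forall h)

theorem LocL2.aestronglyMeasurable {F : Type*} [NormedAddCommGroup F] {f : Rn n → F}
    (hf : LocL2 f) : AEStronglyMeasurable f volume :=
  hf.locallyIntegrable.aestronglyMeasurable

theorem norm_mulField (W : Rn n → Rn n) (f : Rn n → ℂ) (x : Rn n) :
    ‖mulField W f x‖ = ‖W x‖ * ‖f x‖ := by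
  rw [EuclideanSpace.norm_eq, EuclideanSpace.norm_eq, ← Real.sqrt_sq (norm_nonneg (f x)),
    ← Real.sqrt_mul (Finset.sum_nonneg fun _ _ => by positivity), Finset.sum_mul]
  congr 1
  refine Finset.sum_congr rfl fun i _ => ?_
  simp [mulField, mul_pow]

theorem LocL2.locallyIntegrable_mulField {W : Rn n → Rn n} {f : Rn n → ℂ} (hW : LocL2 W)
    (hf : LocL2 f) : LocallyIntegrable (mulField W f) volume := by
  refine hW.locallyIntegrable_of_norm_le hf ?_ fun x => (norm_mulField W f x).le
  have h : AEStronglyMeasurable (fun x => fun i => (W x i : ℂ) * f x) volume := by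
    refine AEMeasurable.aestronglyMeasurable (aemeasurable_pi_lambda _ fun i => ?_)
    exact (Complex.measurable_ofReal.comp_aemeasurable
      (hW.euclidean_apply (𝕜 := ℝ) i).aestronglyMeasurable.aemeasurable).mul
        hf.aestronglyMeasurable.aemeasurable
  exact (PiLp.continuous_toLp 2 _).comp_aestronglyMeasurable h

theorem LocL2.mul_locallyIntegrable {a : Rn n → ℝ} {b : Rn n → ℂ} (ha : LocL2 a) (hb : LocL2 b) :
    LocallyIntegrable (fun x => (a x : ℂ) * b x) volume :=
  ha.locallyIntegrable_of_norm_le hb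
    ((Complex.continuous_ofReal.comp_aestronglyMeasurable ha.aestronglyMeasurable).mul
      hb.aestronglyMeasurable) fun x => by simp

theorem locallyIntegrable_finsetSum {E ι : Type*} [NormedAddCommGroup E] (s : Finset ι)
    {F : ι → Rn n → E} (h : ∀ i ∈ s, LocallyIntegrable (F i) volume) :
    LocallyIntegrable (fun x => ∑ i ∈ s, F i x) volume := by
  classical
  induction s using Finset.induction_on with
  | empty => simpa using locallyIntegrable_zero
  | insert i s his ih =>
    simp only [Finset.sum_insert his]
    exact (h i (Finset.mem_insert_self _ _)).add
      (ih fun j hj => h j (Finset.mem_insert_of_mem hj))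

theorem IsTestFn.integrable_smul {φ : Rn n → ℝ} (hφ : IsTestFn φ) {f : Rn n → ℂ}
    (hf : LocallyIntegrable f volume) : Integrable fun x => φ x • f x :=
  hf.integrable_smul_left_of_hasCompactSupport hφ.1.continuous hφ.2

theorem IsTestFn.integrable_pderiv_smul {φ : Rn n → ℝ} (hφ : IsTestFn φ) (i : Fin n)
    {f : Rn n → ℂ} (hf : LocallyIntegrable f volume) : Integrable fun x => pderiv i φ x • f x :=
  hf.integrable_smul_left_of_hasCompactSupport (hφ.continuous_pderiv i)
    (hφ.2.fderiv_apply (𝕜 := ℝ) _)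

/-- The weak product rule `∇·(Wf) = (∇·W) f + W·∇f`. -/
theorem isWeakDiv_mulField {W : Rn n → Rn n} {d : Rn n → ℝ} (hW : LocL2 W) (hd : LocL2 d)
    (hdiv : IsWeakDiv (𝕜 := ℝ) W d) {f : Rn n → ℂ} {g : Rn n → Vec ℂ n} (hf : LocL2 f)
    (hg : LocL2 g) (hfg : IsWeakGrad f g) :
    IsWeakDiv (mulField W f) fun x => (d x : ℂ) * f x + ∑ i, (W x i : ℂ) * g x i := by
  have hWi := fun i => hW.euclidean_apply (𝕜 := ℝ) i
  have hgi := fun i => hg.euclidean_apply (𝕜 := ℂ) i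
  have hD : LocallyIntegrable (fun x => (d x : ℂ) * f x + ∑ i, (W x i : ℂ) * g x i) volume :=
    (hd.mul_locallyIntegrable hf).add
      (locallyIntegrable_finsetSum _ fun i _ => (hWi i).mul_locallyIntegrable (hgi i))
  have hWf := hW.locallyIntegrable_mulField hf
  refine ⟨hWf, hD, fun φ hφ => ?_⟩
  have hLi : Integrable fun x => ∑ i : Fin n, pderiv i φ x • mulField W f x i :=
    integrable_finsetSum _ fun i _ => hφ.integrable_pderiv_smul i (hWf.euclidean_apply i)
  have hRi := hφ.integrable_smul hD
  -- The product rule is known for real functions; it is applied to `L ∘ f`, and `L = Re, Im`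
  -- recover the complex identity.
  have part : ∀ L : ℂ →L[ℝ] ℝ,
      L (∫ x, ∑ i : Fin n, pderiv i φ x • mulField W f x i)
        = L (-∫ x, φ x • ((d x : ℂ) * f x + ∑ i, (W x i : ℂ) * g x i)) := by
    intro L
    have hLm : ∀ (r : ℝ) (w : ℂ), L ((r : ℂ) * w) = r * L w := fun r w => by
      rw [← Complex.real_smul, L.map_smul, smul_eq_mul]
    have hL2 : ∀ w : Rn n → ℂ, LocL2 w → LocL2 fun x => L (w x) := fun w hw r =>
      L.comp_memLp' (hw r)
    rw [map_neg, ← L.integral_comp_comm hLi, ← L.integral_comp_comm hRi]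
    have h := integral_pderiv_mul_eq hW hd hdiv (hL2 f hf) (fun i => hL2 _ (hgi i))
      (fun ψ hψ i => by
        have h := congrArg L (hfg.2.2 ψ hψ i)
        rw [map_neg, ← L.integral_comp_comm (hψ.integrable_pderiv_smul i hf.locallyIntegrable),
          ← L.integral_comp_comm (hψ.integrable_smul (hgi i).locallyIntegrable)] at h
        simpa only [map_smul, smul_eq_mul] using h) hφ
    simpa only [map_sum, map_smul, map_add, smul_eq_mul, mulField, hLm] using h
  exact Complex.ext (part Complex.reCLM) (part Complex.imCLM)

/-! ### Weighted spaces -/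

theorem continuous_weight (σ : ℝ) : Continuous fun x : Rn n => (1 + ‖x‖ ^ 2) ^ (σ / 2) :=
  Continuous.rpow_const (by fun_prop) fun x => Or.inl (by positivity)

theorem MemWeightedLp.memLp_restrict {F : Type} [NormedAddCommGroup F] [NormedSpace ℝ F]
    {p : ℝ≥0∞} {σ : ℝ} {f : Rn n → F} (hf : MemWeightedLp p σ f) (R : ℝ) :
    MemLp f p (volume.restrict (Metric.closedBall 0 R)) := by
  have hinv : ∀ x : Rn n, (1 + ‖x‖ ^ 2) ^ (-σ / 2) * (1 + ‖x‖ ^ 2) ^ (σ / 2) = 1 := fun x => by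
    rw [← Real.rpow_add (by positivity)]; ring_nf; simp
  have heq : ∀ x, f x = ((1 + ‖x‖ ^ 2) ^ (-σ / 2) : ℝ) • ((1 + ‖x‖ ^ 2) ^ (σ / 2) : ℝ) • f x :=
    fun x => by rw [smul_smul, hinv, one_smul]
  obtain ⟨C, hC⟩ := (isCompact_closedBall (0 : Rn n) R).exists_bound_of_continuousOn
    (continuous_weight (-σ)).continuousOn
  refine (hf.restrict (Metric.closedBall 0 R)).of_le_mul (c := C) ?_ ?_
  · rw [funext heq]
    exact (continuous_weight (-σ)).aestronglyMeasurable.smul hf.1.restrict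
  · filter_upwards [ae_restrict_mem Metric.isClosed_closedBall.measurableSet] with x hx
    nth_rewrite 1 [heq x]
    rw [norm_smul]
    exact mul_le_mul_of_nonneg_right (hC x hx) (norm_nonneg _)

theorem locL2_of_memLp_restrict {F : Type*} [NormedAddCommGroup F] {p : ℝ≥0∞} (hp : 2 ≤ p)
    {f : Rn n → F} (hf : ∀ R : ℝ, MemLp f p (volume.restrict (Metric.closedBall 0 R))) :
    LocL2 f := fun R => by
  have := isFiniteMeasure_restrict_closedBall (n := n) R
  exact (hf R).mono_exponent hp

theorem integrableOn_norm_rpow_compl_closedBall {s : ℝ} (hs : (n : ℝ) < s) {R : ℝ} (hR : 1 ≤ R) :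
    IntegrableOn (fun x : Rn n => ‖x‖ ^ (-s)) (Metric.closedBall 0 R)ᶜ := by
  have hs0 : 0 < s := lt_of_le_of_lt (Nat.cast_nonneg n) hs
  -- The factor `2 ^ s` comes from `1 + ‖x‖ ≤ 2‖x‖` when `‖x‖ ≥ 1`.
  have h := (integrable_one_add_norm (E := Rn n) (μ := volume) (r := s)
    (by simpa using hs)).const_mul (2 ^ s)
  refine h.integrableOn.mono' ?_ ?_
  · exact (measurable_norm.pow_const _).aestronglyMeasurable
  · filter_upwards [ae_restrict_mem Metric.isClosed_closedBall.measurableSet.compl] with x hx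
    rw [mem_compl_iff, mem_closedBall_zero_iff, not_le] at hx
    have hx1 : 1 < ‖x‖ := hR.trans_lt hx
    rw [Real.norm_of_nonneg (by positivity), Real.rpow_neg (by positivity),
      Real.rpow_neg (by positivity), ← div_eq_mul_inv,
      ← Real.div_rpow (by norm_num) (by positivity), ← Real.inv_rpow (by positivity)]
    refine Real.rpow_le_rpow (by positivity) ?_ hs0.le
    rw [inv_eq_one_div, div_le_div_iff₀ (by positivity) (by positivity)]
    linarith

/-! ### The source term -/

theorem DecaysLike.exists_uniform {F : Type} [NormedAddCommGroup F] {μ : ℝ} {g : Rn n → F}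
    (hg : DecaysLike μ g) :
    ∃ c R : ℝ, 0 ≤ c ∧ 1 ≤ R ∧ ∀ᵐ x : Rn n, R ≤ ‖x‖ → ‖g x‖ ≤ c / ‖x‖ ^ μ := by
  obtain ⟨c, R, h⟩ := hg
  refine ⟨|c|, max R 1, abs_nonneg c, le_max_right _ _, ?_⟩
  filter_upwards [h] with x hx hR
  refine (hx ((le_max_left _ _).trans hR)).trans ?_
  gcongr
  exact le_abs_self c

/-- The data entering the far field expansion: the source is integrable, and at infinity it is
bounded by `|y|^{δ₀ - μ}` times a square integrable function. -/
theorem source_estimate {p : ℝ≥0∞} (hp : 2 ≤ p) {δ μ : ℝ} (hμ : 0 ≤ μ)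
    {W : Rn n → Rn n} {V : Rn n → ℝ} (hWV : Admissible p δ μ W V) {δ₀ : ℝ} (hδ₀ : 0 ≤ δ₀)
    (hn : (n : ℝ) < 2 * (μ - δ₀)) {f : Rn n → ℂ} (hf : MemWeightedH1 (-δ₀) f) :
    (∃ d : Rn n → ℂ, IsWeakDiv (mulField W f) d) ∧ Integrable (source W V f) volume ∧
      ∃ (h : Rn n → ℝ) (c R : ℝ), MemLp h 2 volume ∧ 0 ≤ c ∧ 1 ≤ R ∧ ∀ᵐ y : Rn n, R ≤ ‖y‖ →
        ‖source W V f y‖ ≤ c * ‖y‖ ^ (-(μ - δ₀)) * h y := by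
  obtain ⟨hf2, g, hfg, hg2⟩ := hf
  obtain ⟨d, hdiv, hdp, hddec⟩ := hWV.divW
  have hW : LocL2 W := locL2_of_memLp_restrict le_top hWV.W_mem.memLp_restrict
  have hWsq : LocL2 fun x => ‖W x‖ ^ 2 := by
    refine locL2_of_memLp_restrict (p := ⊤) le_top fun R => ?_
    have h := (hWV.W_mem.memLp_restrict R).norm
    have h2 : MemLp ((fun x => ‖W x‖) * fun x => ‖W x‖) ⊤
      (volume.restrict (Metric.closedBall 0 R)) := h.mul h
    exact h2.ae_eq (Eventually.of_forall fun x => (sq _).symm)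
  have hd : LocL2 d := locL2_of_memLp_restrict hp hdp.memLp_restrict
  have hV : LocL2 V := locL2_of_memLp_restrict hp fun R =>
    hWV.V_mem _ (isCompact_closedBall _ _)
  have hfl : LocL2 f := hf2.memLp_restrict
  have hgl : LocL2 g := hg2.memLp_restrict
  have hD := isWeakDiv_mulField hW hd hdiv hfl hgl hfg
  -- the source, up to a null set
  have hsrc : source W V f =ᵐ[volume] fun y =>
      Complex.I * ((d y : ℂ) * f y + ∑ i, (W y i : ℂ) * g y i)
        + Complex.I * (∑ i : Fin n, (W y i : ℂ) * g y i)
        - ((‖W y‖ ^ 2 + V y : ℝ) : ℂ) * f y := by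
    filter_upwards [hD.weakDiv_ae_eq, hfg.weakGrad_ae_eq] with y h1 h2
    rw [source, h1, h2]
  have hmeas : AEStronglyMeasurable (source W V f) volume := by
    have hWg : LocallyIntegrable (fun y => ∑ i : Fin n, (W y i : ℂ) * g y i) volume :=
      locallyIntegrable_finsetSum _ fun i _ =>
        (hW.euclidean_apply (𝕜 := ℝ) i).mul_locallyIntegrable (hgl.euclidean_apply (𝕜 := ℂ) i)
    have hq : AEStronglyMeasurable (fun y => ((‖W y‖ ^ 2 + V y : ℝ) : ℂ) * f y) volume :=
      (Complex.continuous_ofReal.comp_aestronglyMeasurable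
        (hWsq.aestronglyMeasurable.add hV.aestronglyMeasurable)).mul hfl.aestronglyMeasurable
    exact (((hD.2.1.aestronglyMeasurable.const_mul _).add
      (hWg.aestronglyMeasurable.const_mul _)).sub hq).congr hsrc.symm
  -- `Q` collects the coefficients and `F` the unknowns. The weight `2` on `‖W‖` reflects that
  -- `W·∇f` occurs twice, once through `∇·(Wf)`.
  set Q : Rn n → ℝ := fun y => ‖d y‖ + 2 * ‖W y‖ + ‖W y‖ ^ 2 + ‖V y‖ with hQ
  set F : Rn n → ℝ := fun y => ‖f y‖ + ‖g y‖ with hF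
  have hQ0 : ∀ y, 0 ≤ Q y := fun y => by positivity
  have hF0 : ∀ y, 0 ≤ F y := fun y => by positivity
  have hQl : LocL2 Q := fun R =>
    ((((hd R).norm.add ((hW R).norm.const_mul 2)).add (hWsq R)).add (hV R).norm)
  have hFl : LocL2 F := fun R => (hfl R).norm.add (hgl R).norm
  have hWg : ∀ y, ‖∑ i : Fin n, (W y i : ℂ) * g y i‖ ≤ ‖W y‖ * ‖g y‖ := fun y => by
    have h := norm_inner_le_norm (𝕜 := ℂ) (mulField W (fun _ => 1) y) (g y)
    rw [norm_mulField, norm_one, mul_one] at h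
    refine le_trans (le_of_eq ?_) h
    congr 1
    simp [mulField, PiLp.inner_apply, mul_comm]
  have hbound : ∀ᵐ y : Rn n, ‖source W V f y‖ ≤ Q y * F y := by
    filter_upwards [hsrc] with y hy
    rw [hy]
    have h1 := hWg y
    have h2 : ‖((‖W y‖ ^ 2 + V y : ℝ) : ℂ) * f y‖ ≤ (‖W y‖ ^ 2 + ‖V y‖) * ‖f y‖ := by
      rw [norm_mul, Complex.norm_real]
      gcongr
      refine (norm_add_le _ _).trans ?_
      rw [Real.norm_of_nonneg (by positivity : 0 ≤ ‖W y‖ ^ 2)]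
    have h3 : ‖Complex.I * ((d y : ℂ) * f y + ∑ i, (W y i : ℂ) * g y i)‖
        ≤ ‖d y‖ * ‖f y‖ + ‖W y‖ * ‖g y‖ := by
      rw [norm_mul, Complex.norm_I, one_mul]
      refine (norm_add_le _ _).trans (add_le_add ?_ h1)
      rw [norm_mul, Complex.norm_real]
    have h4 : ‖Complex.I * ∑ i, (W y i : ℂ) * g y i‖ ≤ ‖W y‖ * ‖g y‖ := by
      rw [norm_mul, Complex.norm_I, one_mul]; exact h1
    have h5 := (norm_sub_le (Complex.I * ((d y : ℂ) * f y + ∑ i, (W y i : ℂ) * g y i)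
        + Complex.I * (∑ i : Fin n, (W y i : ℂ) * g y i)) (((‖W y‖ ^ 2 + V y : ℝ) : ℂ) * f y))
    have h6 := norm_add_le (Complex.I * ((d y : ℂ) * f y + ∑ i, (W y i : ℂ) * g y i))
        (Complex.I * (∑ i : Fin n, (W y i : ℂ) * g y i))
    have e : Q y * F y = (‖d y‖ * ‖f y‖ + ‖W y‖ * ‖g y‖) + ‖W y‖ * ‖g y‖
        + (‖W y‖ ^ 2 + ‖V y‖) * ‖f y‖ + (‖d y‖ * ‖g y‖ + 2 * (‖W y‖ * ‖f y‖)
        + (‖W y‖ ^ 2 + ‖V y‖) * ‖g y‖) := by simp only [hQ, hF]; ring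
    have : 0 ≤ ‖d y‖ * ‖g y‖ + 2 * (‖W y‖ * ‖f y‖)
        + (‖W y‖ ^ 2 + ‖V y‖) * ‖g y‖ := by positivity
    linarith
  obtain ⟨c₁, R₁, hc₁, hR₁, hd₁⟩ := hddec.exists_uniform
  obtain ⟨c₂, R₂, hc₂, hR₂, hd₂⟩ := hWV.W_decay.exists_uniform
  obtain ⟨c₃, R₃, hc₃, hR₃, hd₃⟩ := hWV.V_decay.exists_uniform
  set h : Rn n → ℝ := fun y => (1 + ‖y‖ ^ 2) ^ (-δ₀ / 2) * F y with hh
  have hh2 : MemLp h 2 volume := by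
    refine (hf2.norm.add hg2.norm).ae_eq (Eventually.of_forall fun y => ?_)
    have : 0 ≤ (1 + ‖y‖ ^ 2) ^ (-δ₀ / 2) := by positivity
    simp only [Pi.add_apply, norm_smul, Real.norm_of_nonneg this, hh, hF]
    ring
  set R := max R₁ (max R₂ R₃) with hR
  set C := c₁ + 2 * c₂ + c₂ ^ 2 + c₃ with hC
  have hC0 : 0 ≤ C := by positivity
  have hR1 : 1 ≤ R := hR₁.trans (le_max_left _ _)
  have hdec : ∀ᵐ y : Rn n, R ≤ ‖y‖ →
      ‖source W V f y‖ ≤ C * 2 ^ (δ₀ / 2) * ‖y‖ ^ (-(μ - δ₀)) * h y := by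
    filter_upwards [hbound, hd₁, hd₂, hd₃] with y hb h1 h2 h3 hy
    have hy1 : 1 ≤ ‖y‖ := hR1.trans hy
    have hy0 : 0 < ‖y‖ := by linarith
    have h1' := h1 ((le_max_left _ _).trans hy)
    have h2' := h2 ((le_max_left _ _).trans ((le_max_right _ _).trans hy))
    have h3' := h3 ((le_max_right _ _).trans ((le_max_right _ _).trans hy))
    have hm1 : 1 ≤ ‖y‖ ^ μ := Real.one_le_rpow hy1 hμ
    -- The square decays like `|y|^{-2μ}`; one factor is discarded since `|y|^μ ≥ 1`.
    have h4 : ‖W y‖ ^ 2 ≤ c₂ ^ 2 / ‖y‖ ^ μ := by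
      calc ‖W y‖ ^ 2 ≤ (c₂ / ‖y‖ ^ μ) ^ 2 := by gcongr
        _ = c₂ ^ 2 / (‖y‖ ^ μ * ‖y‖ ^ μ) := by rw [div_pow, sq (‖y‖ ^ μ)]
        _ ≤ c₂ ^ 2 / ‖y‖ ^ μ := by
          gcongr
          nlinarith
    have hQy : Q y ≤ C / ‖y‖ ^ μ := by
      have : C / ‖y‖ ^ μ = c₁ / ‖y‖ ^ μ + 2 * (c₂ / ‖y‖ ^ μ) + c₂ ^ 2 / ‖y‖ ^ μ + c₃ / ‖y‖ ^ μ := by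
        rw [hC]; ring
      rw [this]
      simp only [hQ]
      linarith
    have hFy : F y ≤ 2 ^ (δ₀ / 2) * ‖y‖ ^ δ₀ * h y := by
      have e1 : F y = (1 + ‖y‖ ^ 2) ^ (δ₀ / 2) * h y := by
        rw [hh]
        beta_reduce
        rw [← mul_assoc, ← Real.rpow_add (by positivity)]
        ring_nf
        simp
      have e2 : (1 + ‖y‖ ^ 2) ^ (δ₀ / 2) ≤ 2 ^ (δ₀ / 2) * ‖y‖ ^ δ₀ := by
        have : ‖y‖ ^ δ₀ = (‖y‖ ^ 2) ^ (δ₀ / 2) := by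
          rw [← Real.rpow_natCast, ← Real.rpow_mul hy0.le]; congr 1; push_cast; ring
        rw [this, ← Real.mul_rpow (by norm_num) (by positivity)]
        refine Real.rpow_le_rpow (by positivity) ?_ (by positivity)
        nlinarith
      rw [e1]
      exact mul_le_mul_of_nonneg_right e2 (mul_nonneg (by positivity) (hF0 y))
    calc ‖source W V f y‖ ≤ Q y * F y := hb
      _ ≤ C / ‖y‖ ^ μ * (2 ^ (δ₀ / 2) * ‖y‖ ^ δ₀ * h y) :=
        mul_le_mul hQy hFy (hF0 y) (by positivity)
      _ = C * 2 ^ (δ₀ / 2) * ‖y‖ ^ (-(μ - δ₀)) * h y := by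
        rw [neg_sub, Real.rpow_sub hy0]; ring
  refine ⟨⟨_, hD⟩, ?_, h, C * 2 ^ (δ₀ / 2), R, hh2, by positivity, hR1, hdec⟩
  -- On the ball the source is dominated by a product of two `L²` functions. Outside it, `|y|^{-a} h
  -- ≤ |y|^{-2a} + h²` with `a = μ - δ₀`, which is integrable because `2a > n`.
  rw [← integrableOn_univ, ← union_compl_self (Metric.closedBall (0 : Rn n) R)]
  refine IntegrableOn.union ?_ ?_
  · refine ((hQl R).integrable_mul (hFl R)).mono' hmeas.restrict (ae_restrict_of_ae ?_)
    exact hbound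
  · have i1 := integrableOn_norm_rpow_compl_closedBall hn hR1
    have i2 : IntegrableOn (fun y => h y ^ 2) (Metric.closedBall (0 : Rn n) R)ᶜ :=
      hh2.integrable_sq.integrableOn
    refine ((i1.add i2).const_mul (C * 2 ^ (δ₀ / 2))).mono' hmeas.restrict ?_
    filter_upwards [ae_restrict_of_ae hdec,
      ae_restrict_mem Metric.isClosed_closedBall.measurableSet.compl] with y hy hyR
    rw [mem_compl_iff, mem_closedBall_zero_iff, not_le] at hyR
    refine (hy hyR.le).trans ?_
    rw [mul_assoc]
    refine mul_le_mul_of_nonneg_left ?_ (by positivity)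
    have e : ‖y‖ ^ (-(2 * (μ - δ₀))) = (‖y‖ ^ (-(μ - δ₀))) ^ 2 := by
      rw [← Real.rpow_natCast, ← Real.rpow_mul (norm_nonneg _)]; congr 1; push_cast; ring
    simp only [Pi.add_apply]
    rw [e]
    nlinarith [sq_nonneg (‖y‖ ^ (-(μ - δ₀)) - h y), sq_nonneg (‖y‖ ^ (-(μ - δ₀))),
      sq_nonneg (h y)]

/-! ### The region near the observation point -/

/-- In polar coordinates the density `r^{n-1}` cancels the singularity exactly, leaving the length
of `(0, ρ]`. -/
theorem integrable_and_integral_indicator_norm_rpow (hn : 1 ≤ n) (x : Rn n) {ρ : ℝ} (hρ : 0 ≤ ρ) :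
    Integrable (fun y : Rn n => (Iic ρ).indicator (fun r : ℝ => r ^ (-((n : ℝ) - 1))) ‖x - y‖) ∧
      ∫ y : Rn n, (Iic ρ).indicator (fun r : ℝ => r ^ (-((n : ℝ) - 1))) ‖x - y‖
        = n * (volume : Measure (Rn n)).real (Metric.ball 0 1) * ρ := by
  have : Nonempty (Fin n) := ⟨⟨0, hn⟩⟩
  set φ : ℝ → ℝ := (Iic ρ).indicator fun r : ℝ => r ^ (-((n : ℝ) - 1)) with hφ
  have hcast : ((n - 1 : ℕ) : ℝ) = (n : ℝ) - 1 := by push_cast [hn]; ring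
  have hrad : ∀ r ∈ Ioi (0 : ℝ), r ^ (n - 1) • φ r = (Iic ρ).indicator (fun _ => (1 : ℝ)) r := by
    intro r hr
    have hr0 : (0 : ℝ) < r := hr
    by_cases h : r ∈ Iic ρ
    · rw [hφ, indicator_of_mem h, indicator_of_mem h, smul_eq_mul, ← Real.rpow_natCast,
        ← Real.rpow_add hr0, hcast, add_neg_cancel, Real.rpow_zero]
    · rw [hφ, indicator_of_notMem h, indicator_of_notMem h, smul_zero]
  have hset : Iic ρ ∩ Ioi 0 = Ioc 0 ρ := by ext r; simp [and_comm]
  have h1 : IntegrableOn (fun r : ℝ => r ^ (n - 1) • φ r) (Ioi 0) := by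
    refine (integrableOn_congr_fun hrad measurableSet_Ioi).2 ?_
    rw [IntegrableOn, integrable_indicator_iff measurableSet_Iic, IntegrableOn,
      Measure.restrict_restrict measurableSet_Iic, hset]
    exact integrableOn_const (by simp)
  have h2 : ∫ r in Ioi (0 : ℝ), r ^ (n - 1) • φ r = ρ := by
    rw [setIntegral_congr_fun measurableSet_Ioi hrad, integral_indicator measurableSet_Iic,
      Measure.restrict_restrict measurableSet_Iic, hset]
    simp [hρ]
  have hI : Integrable (fun y : Rn n => φ ‖y‖) := by
    rw [integrable_fun_norm_addHaar (volume : Measure (Rn n))]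
    simpa using h1
  refine ⟨hI.comp_sub_left x, ?_⟩
  rw [integral_sub_left_eq_self (fun y : Rn n => φ ‖y‖) volume x, integral_fun_norm_addHaar]
  simp only [finrank_euclideanSpace, Fintype.card_fin]
  rw [h2]
  simp [mul_assoc]

/-- Off a neighbourhood of the origin, the contribution of the ball `|x - y| ≤ |x|/2` to the
integral of the kernel against the source decays like `|x|^{1/2 - a}`. -/
theorem exists_near_bound (hn : n = 2 ∨ n = 3) {k : ℝ} (hk : 0 < k) {S : Rn n → ℂ}
    (hS : Integrable S) {h : Rn n → ℝ} (hh : MemLp h 2 volume) {c R a : ℝ} (hc : 0 ≤ c)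
    (hR : 1 ≤ R) (ha : 0 ≤ a)
    (hdec : ∀ᵐ y : Rn n, R ≤ ‖y‖ → ‖S y‖ ≤ c * ‖y‖ ^ (-a) * h y) :
    ∃ K : ℝ, ∀ x : Rn n, 2 * R ≤ ‖x‖ →
      IntegrableOn (fun y => greenFn n k ‖x - y‖ * S y) (Metric.closedBall x (‖x‖ / 2)) ∧
      ∫ y in Metric.closedBall x (‖x‖ / 2), ‖greenFn n k ‖x - y‖ * S y‖
        ≤ K * ‖x‖ ^ (1 / 2 - a) := by
  have hn1 : 1 ≤ n := by omega
  have : Nonempty (Fin n) := ⟨⟨0, hn1⟩⟩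
  obtain ⟨C, hC0, hC⟩ := exists_rpow_mul_norm_greenFn_le hn hk
  set vB := (volume : Measure (Rn n)).real (Metric.ball 0 1)
  set H := ∫ y, h y ^ 2
  have hvB : 0 ≤ vB := measureReal_nonneg
  refine ⟨C * c * 2 ^ a * (n * vB / 2 + H), fun x hx => ?_⟩
  have hx0 : 0 < ‖x‖ := by linarith
  obtain ⟨hI, hV⟩ := integrable_and_integral_indicator_norm_rpow hn1 x
    (by positivity : 0 ≤ ‖x‖ / 2)
  set Φ : Rn n → ℝ := fun y =>
    (Iic (‖x‖ / 2)).indicator (fun r : ℝ => r ^ (-((n : ℝ) - 1))) ‖x - y‖ with hΦ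
  set D : ℝ := C * c * (‖x‖ / 2) ^ (-a) with hD
  have hD0 : 0 ≤ D := by positivity
  -- Weighted arithmetic–geometric mean for `r^{-(n-1)/2} |h|`. Since `∫ Φ` is of order `|x|`, the
  -- weights `|x|^{∓1/2}` make both terms of order `|x|^{1/2}`.
  set B : Rn n → ℝ := fun y => D * (‖x‖ ^ (-(1 / 2) : ℝ) * Φ y + ‖x‖ ^ (1 / 2 : ℝ) * h y ^ 2)
    with hB
  have hBi : Integrable B :=
    ((hI.const_mul _).add (hh.integrable_sq.const_mul _)).const_mul D
  have hΦ0 : ∀ y, 0 ≤ Φ y := fun y => indicator_apply_nonneg fun _ => by positivity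
  have hB0 : ∀ y, 0 ≤ B y := fun y => by have := hΦ0 y; positivity
  have hmeas : AEStronglyMeasurable (fun y => greenFn n k ‖x - y‖ * S y) volume :=
    (((measurable_greenFn n k).comp (by fun_prop : Measurable fun y : Rn n => ‖x - y‖))
      |>.aestronglyMeasurable).mul hS.1
  have hle : ∀ᵐ y ∂(volume.restrict (Metric.closedBall x (‖x‖ / 2))),
      ‖greenFn n k ‖x - y‖ * S y‖ ≤ B y := by
    -- The kernel bound requires `r > 0`; the single point `y = x` is null.
    have hne : ∀ᵐ y : Rn n, y ≠ x := by
      simp [ae_iff]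
    filter_upwards [ae_restrict_of_ae hdec, ae_restrict_of_ae hne,
      ae_restrict_mem Metric.isClosed_closedBall.measurableSet] with y hy hyx hyB
    rw [mem_closedBall_iff_norm, norm_sub_rev] at hyB
    have hr0 : 0 < ‖x - y‖ := norm_pos_iff.2 (sub_ne_zero.2 hyx.symm)
    have hynorm : ‖x‖ / 2 ≤ ‖y‖ := by linarith [norm_sub_norm_le x y]
    set r := ‖x - y‖ with hr
    have hSy : ‖S y‖ ≤ c * (‖x‖ / 2) ^ (-a) * |h y| := by
      refine (hy (by linarith)).trans ?_
      have h1 : ‖y‖ ^ (-a) ≤ (‖x‖ / 2) ^ (-a) :=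
        Real.rpow_le_rpow_of_nonpos (by positivity) hynorm (by linarith)
      calc c * ‖y‖ ^ (-a) * h y ≤ c * ‖y‖ ^ (-a) * |h y| := by
            gcongr; exact le_abs_self _
        _ ≤ _ := by gcongr
    have hG : ‖greenFn n k r‖ ≤ C * r ^ (-(((n : ℝ) - 1) / 2)) := by
      have := hC r hr0
      rw [Real.rpow_neg hr0.le, ← div_eq_mul_inv, le_div_iff₀ (by positivity), mul_comm]
      exact this
    have hΦy : Φ y = (r ^ (-(((n : ℝ) - 1) / 2))) ^ 2 := by
      rw [hΦ]
      beta_reduce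
      rw [indicator_of_mem (show ‖x - y‖ ∈ Iic (‖x‖ / 2) from hyB), ← hr, ← Real.rpow_natCast,
        ← Real.rpow_mul hr0.le]
      congr 1; push_cast; ring
    set α := r ^ (-(((n : ℝ) - 1) / 2)) with hα
    have hα0 : 0 ≤ α := by positivity
    have hxx : ‖x‖ ^ (-(1 / 2) : ℝ) * ‖x‖ ^ (1 / 2 : ℝ) = 1 := by
      rw [← Real.rpow_add hx0]; simp
    have hAMGM : α * |h y| ≤ ‖x‖ ^ (-(1 / 2) : ℝ) * Φ y + ‖x‖ ^ (1 / 2 : ℝ) * h y ^ 2 := by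
      rw [hΦy, ← sq_abs (h y)]
      set u := ‖x‖ ^ (-(1 / 2) : ℝ)
      set v := ‖x‖ ^ (1 / 2 : ℝ)
      have hu : 0 < u := by positivity
      have hv : 0 < v := by positivity
      have hb := abs_nonneg (h y)
      have e : u * α ^ 2 + v * |h y| ^ 2 - 2 * (α * |h y|) = v * (u * α - |h y|) ^ 2 := by
        have : v * (u * α - |h y|) ^ 2
          = (u * v) * u * α ^ 2 + v * |h y| ^ 2 - 2 * (u * v) * (α * |h y|) := by ring
        rw [this, hxx]; ring
      nlinarith [mul_nonneg hv.le (sq_nonneg (u * α - |h y|)), mul_nonneg hα0 hb]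
    rw [norm_mul]
    calc ‖greenFn n k r‖ * ‖S y‖ ≤ (C * α) * (c * (‖x‖ / 2) ^ (-a) * |h y|) :=
          mul_le_mul hG hSy (norm_nonneg _) (by positivity)
      _ = D * (α * |h y|) := by rw [hD]; ring
      _ ≤ B y := mul_le_mul_of_nonneg_left hAMGM hD0
  have hInt : IntegrableOn (fun y => greenFn n k ‖x - y‖ * S y) (Metric.closedBall x (‖x‖ / 2)) :=
    hBi.integrableOn.mono' hmeas.restrict hle
  refine ⟨hInt, ?_⟩
  calc _ ≤ ∫ y in Metric.closedBall x (‖x‖ / 2), B y :=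
        integral_mono_ae hInt.norm hBi.integrableOn hle
    _ ≤ ∫ y, B y := setIntegral_le_integral hBi (Eventually.of_forall hB0)
    _ = D * (‖x‖ ^ (-(1 / 2) : ℝ) * (n * vB * (‖x‖ / 2)) + ‖x‖ ^ (1 / 2 : ℝ) * H) := by
        rw [integral_const_mul, integral_add (hI.const_mul _) (hh.integrable_sq.const_mul _),
          integral_const_mul, integral_const_mul, hV]
    _ = C * c * 2 ^ a * (n * vB / 2 + H) * ‖x‖ ^ (1 / 2 - a) := by
        have e1 : ‖x‖ ^ (1 / 2 : ℝ) = ‖x‖ ^ (-(1 / 2) : ℝ) * ‖x‖ := by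
          nth_rewrite 3 [← Real.rpow_one ‖x‖]
          rw [← Real.rpow_add hx0]; norm_num
        have e2 : (‖x‖ / 2) ^ (-a) = 2 ^ a * ‖x‖ ^ (-a) := by
          rw [Real.div_rpow hx0.le (by norm_num), Real.rpow_neg (by norm_num : (0 : ℝ) ≤ 2)]
          field_simp
        rw [hD, e2, sub_eq_add_neg, Real.rpow_add hx0, e1]
        ring

/-! ### Pointwise asymptotics of the kernel -/

theorem tendsto_norm_sub_cobounded (y : Rn n) :
    Tendsto (fun x : Rn n => ‖x - y‖) (cobounded (Rn n)) atTop :=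
  tendsto_atTop_mono (fun x => norm_sub_norm_le x y)
    (tendsto_atTop_add_const_right _ _ tendsto_norm_cobounded_atTop)

/-- With `r = |x - y|` and `t = (θ', y)`, the identity `(r - |x| + t)(r + |x|) = |y|² + t (r - |x|)`
bounds the error by `2|y|²/|x|`, independently of the direction. -/
theorem tendsto_norm_sub_phase (y : Rn n) :
    Tendsto (fun x : Rn n => ‖x - y‖ - ‖x‖ + inner ℝ (‖x‖⁻¹ • x) y) (cobounded (Rn n)) (𝓝 0) := by
  have hlim : Tendsto (fun x : Rn n => 2 * ‖y‖ ^ 2 * ‖x‖⁻¹) (cobounded (Rn n)) (𝓝 0) := by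
    simpa using (tendsto_norm_cobounded_atTop.inv_tendsto_atTop).const_mul (2 * ‖y‖ ^ 2)
  refine squeeze_zero_norm' ?_ hlim
  filter_upwards [tendsto_norm_cobounded_atTop.eventually (eventually_gt_atTop 0)] with x hx
  set r := ‖x - y‖ with hr
  set t := inner ℝ (‖x‖⁻¹ • x) y with ht
  have hr0 : 0 ≤ r := norm_nonneg _
  have hxy : inner ℝ x y = ‖x‖ * t := by
    rw [ht, real_inner_smul_left]; field_simp
  have ht1 : |t| ≤ ‖y‖ := by
    refine (abs_real_inner_le_norm _ _).trans ?_
    rw [norm_smul, norm_inv, norm_norm, inv_mul_cancel₀ hx.ne', one_mul]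
  have hsq : r ^ 2 = ‖x‖ ^ 2 - 2 * (‖x‖ * t) + ‖y‖ ^ 2 := by
    rw [hr, norm_sub_sq_real, hxy]
  have hd : |r - ‖x‖| ≤ ‖y‖ := by
    have := abs_norm_sub_norm_le (x - y) x
    simpa [hr] using this
  have key : (r - ‖x‖ + t) * (r + ‖x‖) = ‖y‖ ^ 2 + t * (r - ‖x‖) := by nlinarith
  have hk2 : |t * (r - ‖x‖)| ≤ ‖y‖ ^ 2 := by
    rw [abs_mul, sq]; exact mul_le_mul ht1 hd (abs_nonneg _) (norm_nonneg _)
  rw [Real.norm_eq_abs, ← div_eq_mul_inv, le_div_iff₀ hx]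
  calc |r - ‖x‖ + t| * ‖x‖ ≤ |r - ‖x‖ + t| * (r + ‖x‖) := by
        gcongr; linarith
    _ = |(r - ‖x‖ + t) * (r + ‖x‖)| := by rw [abs_mul, abs_of_nonneg (by positivity : 0 ≤ r + ‖x‖)]
    _ ≤ ‖y‖ ^ 2 + |t * (r - ‖x‖)| := by
        rw [key]; refine (abs_add_le _ _).trans ?_; rw [abs_of_nonneg (by positivity)]
    _ ≤ 2 * ‖y‖ ^ 2 := by linarith

theorem tendsto_norm_div_norm_sub (y : Rn n) :
    Tendsto (fun x : Rn n => ‖x‖ / ‖x - y‖) (cobounded (Rn n)) (𝓝 1) := by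
  rw [tendsto_iff_norm_sub_tendsto_zero]
  have hlim : Tendsto (fun x : Rn n => ‖y‖ * ‖x - y‖⁻¹) (cobounded (Rn n)) (𝓝 0) := by
    simpa using ((tendsto_norm_sub_cobounded y).inv_tendsto_atTop).const_mul ‖y‖
  refine squeeze_zero' (Eventually.of_forall fun _ => norm_nonneg _) ?_ hlim
  filter_upwards [(tendsto_norm_sub_cobounded y).eventually (eventually_gt_atTop 0)] with x hx
  have h1 : ‖x‖ / ‖x - y‖ - 1 = (‖x‖ - ‖x - y‖) / ‖x - y‖ := by field_simp
  rw [h1, norm_div, norm_norm, ← div_eq_mul_inv]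
  gcongr
  have := abs_norm_sub_norm_le x (x - y)
  simpa using this

/-- Neither term converges by itself. Dividing by the unimodular factor `e^{ikr}`, `r = |x - y|`,
leaves two terms that both tend to `A`: the first by the kernel asymptotics and `|x|/r → 1`, the
second by the phase expansion. -/
theorem tendsto_kernel_sub_planeWave (hn : n = 2 ∨ n = 3) {k : ℝ} (hk : 0 < k) (y : Rn n) :
    Tendsto (fun x : Rn n => ((‖x‖ ^ (((n : ℝ) - 1) / 2) : ℝ) : ℂ) * greenFn n k ‖x - y‖
        - farFieldConst n * ((k ^ (((n : ℝ) - 3) / 2) : ℝ) : ℂ)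
          * (Complex.exp (Complex.I * (k : ℂ) * (‖x‖ : ℂ))
            * Complex.exp (-(Complex.I * (k : ℂ) * ((inner ℝ (‖x‖⁻¹ • x) y : ℝ) : ℂ)))))
      (cobounded (Rn n)) (𝓝 0) := by
  set A := farFieldConst n * ((k ^ (((n : ℝ) - 3) / 2) : ℝ) : ℂ) with hA
  set s := ((n : ℝ) - 1) / 2 with hs
  have h1 := (tendsto_rpow_mul_greenFn hn hk).comp (tendsto_norm_sub_cobounded y)
  have h2 : Tendsto (fun x : Rn n => (((‖x‖ / ‖x - y‖) ^ s : ℝ) : ℂ)) (cobounded (Rn n)) (𝓝 1) := by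
    have := (tendsto_norm_div_norm_sub y).rpow_const (p := s) (Or.inl one_ne_zero)
    rw [Real.one_rpow] at this
    exact_mod_cast (Complex.continuous_ofReal.tendsto 1).comp this
  have h3 : Tendsto (fun x : Rn n => Complex.exp (-(Complex.I * k
      * ((‖x - y‖ - ‖x‖ + inner ℝ (‖x‖⁻¹ • x) y : ℝ) : ℂ)))) (cobounded (Rn n)) (𝓝 1) := by
    have hc : Continuous fun τ : ℝ => Complex.exp (-(Complex.I * k * (τ : ℂ))) := by fun_prop
    have := (hc.tendsto 0).comp (tendsto_norm_sub_phase y)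
    simp only [Complex.ofReal_zero, mul_zero, neg_zero, Complex.exp_zero] at this
    exact this
  have h4 := ((h2.mul h1).sub (h3.const_mul A)).norm
  rw [one_mul, mul_one, sub_self, norm_zero] at h4
  rw [tendsto_zero_iff_norm_tendsto_zero]
  refine h4.congr' ?_
  filter_upwards [(tendsto_norm_sub_cobounded y).eventually (eventually_gt_atTop 0)] with x hx
  set r := ‖x - y‖ with hr
  have he : ‖Complex.exp (Complex.I * (k * r : ℝ))‖ = 1 := by rw [Complex.norm_exp]; simp
  have hmul : ∀ w : ℂ, ‖w‖ = ‖Complex.exp (Complex.I * (k * r : ℝ)) * w‖ := fun w => by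
    rw [norm_mul, he, one_mul]
  refine (hmul _).trans (congrArg norm ?_)
  rw [mul_sub]
  congr 1
  · have e1 : ((‖x‖ / r) ^ s : ℝ) * r ^ s = ‖x‖ ^ s := by
      rw [Real.div_rpow (norm_nonneg _) hx.le]; field_simp
    have e2 : Complex.exp (Complex.I * (k * r : ℝ)) * Complex.exp (-Complex.I * (k * r : ℝ)) = 1 := by
      rw [← Complex.exp_add]; simp
    rw [← e1]
    simp only [Function.comp_apply, ← hr, ← hs]
    push_cast at e2 ⊢
    linear_combination (((‖x‖ / r) ^ s : ℝ) : ℂ) * ((r ^ s : ℝ) : ℂ) * greenFn n k r * e2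
  · rw [mul_left_comm, ← Complex.exp_add, ← Complex.exp_add]
    congr 2
    push_cast
    ring

/-! ### The far field expansion -/

/-- Far field asymptotics of `∫ G_k^+(|x-y|) S(y) dy` for an integrable source `S` bounded at
infinity by `|y|^{-a}` times a square integrable function, `a > n/2`. -/
theorem farField_expansion (hn : n = 2 ∨ n = 3) {k : ℝ} (hk : 0 < k) {S : Rn n → ℂ}
    (hS : Integrable S) {h : Rn n → ℝ} (hh : MemLp h 2 volume) {c R a : ℝ} (hc : 0 ≤ c)
    (hR : 1 ≤ R) (ha : (n : ℝ) / 2 < a)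
    (hdec : ∀ᵐ y : Rn n, R ≤ ‖y‖ → ‖S y‖ ≤ c * ‖y‖ ^ (-a) * h y) :
    (∀ᶠ x in cobounded (Rn n), Integrable (fun y => greenFn n k ‖x - y‖ * S y) volume) ∧
    (fun x : Rn n =>
        (∫ y, greenFn n k ‖x - y‖ * S y)
          - farFieldConst n
            * (Complex.exp (Complex.I * (k : ℂ) * (‖x‖ : ℂ))
                * ((k ^ (((n : ℝ) - 3) / 2) : ℝ) : ℂ)
                / ((‖x‖ ^ (((n : ℝ) - 1) / 2) : ℝ) : ℂ))
            * ∫ y, Complex.exp (-(Complex.I * (k : ℂ) * ((inner ℝ (‖x‖⁻¹ • x) y : ℝ) : ℂ))) * S y)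
      =o[cobounded (Rn n)] fun x : Rn n => 1 / ‖x‖ ^ (((n : ℝ) - 1) / 2) := by
  have hs0 : 0 ≤ ((n : ℝ) - 1) / 2 := by rcases hn with rfl | rfl <;> norm_num
  have ha0 : 0 ≤ a := le_trans (by positivity) ha.le
  have : (cobounded (Rn n)).IsCountablyGenerated := by
    -- Countable generation of the filter is what dominated convergence along it requires.
    rw [← comap_norm_atTop]; infer_instance
  obtain ⟨C, hC0, hC⟩ := exists_rpow_mul_norm_greenFn_le hn hk
  obtain ⟨K, hK⟩ := exists_near_bound hn hk hS hh hc hR ha0 hdec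
  have hker := tendsto_kernel_sub_planeWave hn hk
  obtain ⟨A, hA⟩ : ∃ A, A = farFieldConst n * ((k ^ (((n : ℝ) - 3) / 2) : ℝ) : ℂ) := ⟨_, rfl⟩
  set s := ((n : ℝ) - 1) / 2 with hs
  set N : Rn n → Set (Rn n) := fun x => Metric.closedBall x (‖x‖ / 2) with hN
  have hNm : ∀ x, MeasurableSet (N x) := fun x => Metric.isClosed_closedBall.measurableSet
  set e : Rn n → Rn n → ℂ := fun x y => Complex.exp (Complex.I * (k : ℂ) * (‖x‖ : ℂ))
    * Complex.exp (-(Complex.I * (k : ℂ) * ((inner ℝ (‖x‖⁻¹ • x) y : ℝ) : ℂ))) with he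
  have he1 : ∀ x y, ‖e x y‖ = 1 := fun x y => by
    rw [he, norm_mul, Complex.norm_exp, Complex.norm_exp]; simp
  have hec : ∀ x, Continuous (e x) := fun x => by
    simp only [he]; fun_prop
  have hgm : ∀ x, AEStronglyMeasurable (fun y => greenFn n k ‖x - y‖) volume := fun x =>
    ((measurable_greenFn n k).comp (by fun_prop : Measurable fun y : Rn n => ‖x - y‖))
      |>.aestronglyMeasurable
  have hfar : ∀ x : Rn n, 0 < ‖x‖ → ∀ y ∈ (N x)ᶜ,
      ‖x‖ ^ s * ‖greenFn n k ‖x - y‖‖ ≤ C * 2 ^ s := by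
    intro x hx y hy
    have hy' : ‖x‖ / 2 < ‖x - y‖ := by
      rwa [mem_compl_iff, mem_closedBall_iff_norm, not_le, norm_sub_rev] at hy
    have hr0 : 0 < ‖x - y‖ := by linarith
    calc ‖x‖ ^ s * ‖greenFn n k ‖x - y‖‖ ≤ (2 * ‖x - y‖) ^ s * ‖greenFn n k ‖x - y‖‖ := by
          gcongr; linarith
      _ = (‖x - y‖ ^ s * ‖greenFn n k ‖x - y‖‖) * 2 ^ s := by
          rw [Real.mul_rpow (by norm_num) hr0.le]; ring
      _ ≤ C * 2 ^ s := by gcongr; exact hC _ hr0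
  have hlarge : ∀ᶠ x in cobounded (Rn n), 2 * R ≤ ‖x‖ :=
    tendsto_norm_cobounded_atTop.eventually (eventually_ge_atTop _)
  have hInt : ∀ x : Rn n, 2 * R ≤ ‖x‖ → Integrable (fun y => greenFn n k ‖x - y‖ * S y) := by
    intro x hx
    have hx0 : 0 < ‖x‖ := by linarith
    rw [← integrableOn_univ, ← union_compl_self (N x)]
    refine (hK x hx).1.union ?_
    refine (hS.norm.const_mul (C * 2 ^ s / ‖x‖ ^ s)).integrableOn.mono'
      ((hgm x).mul hS.1).restrict ?_
    filter_upwards [ae_restrict_mem (hNm x).compl] with y hy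
    rw [norm_mul]
    refine mul_le_mul_of_nonneg_right ?_ (norm_nonneg _)
    rw [le_div_iff₀ (by positivity), mul_comm]
    exact hfar x hx0 y hy
  refine ⟨hlarge.mono hInt, ?_⟩
  -- the three contributions to the remainder
  have t1 : Tendsto (fun x : Rn n => K * ‖x‖ ^ ((n : ℝ) / 2 - a)) (cobounded (Rn n)) (𝓝 0) := by
    have := ((tendsto_rpow_neg_atTop (sub_pos.2 ha)).comp
      (tendsto_norm_cobounded_atTop (E := Rn n))).const_mul K
    simpa [Function.comp_def] using this
  -- Far region: the rescaled kernel minus the plane wave, dominated by a multiple of `‖S‖` and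
  -- tending to zero for each fixed `y`.
  set P : Rn n → Rn n → ℂ := fun x y => (N x)ᶜ.indicator
    (fun y => (((‖x‖ ^ s : ℝ) : ℂ) * greenFn n k ‖x - y‖ - A * e x y) * S y) y with hP
  have t2 : Tendsto (fun x : Rn n => ∫ y, P x y) (cobounded (Rn n)) (𝓝 0) := by
    have hb0 : 0 ≤ C * 2 ^ s + ‖A‖ := by positivity
    have := tendsto_integral_filter_of_dominated_convergence (l := cobounded (Rn n)) (F := P)
      (f := fun _ => 0) (μ := volume) (fun y => (C * 2 ^ s + ‖A‖) * ‖S y‖) ?_ ?_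
      (hS.norm.const_mul _) ?_
    · simpa using this
    · exact Eventually.of_forall fun x =>
        ((((hgm x).const_mul _).sub ((hec x).aestronglyMeasurable.const_mul A)).mul hS.1).indicator
          (hNm x).compl
    · filter_upwards [hlarge] with x hx
      refine Eventually.of_forall fun y => ?_
      have hx0 : 0 < ‖x‖ := by linarith
      by_cases hy : y ∈ (N x)ᶜ
      · rw [hP]
        simp only [indicator_of_mem hy]
        rw [norm_mul]
        refine mul_le_mul_of_nonneg_right ((norm_sub_le _ _).trans (add_le_add ?_ ?_))
          (norm_nonneg _)
        · rw [norm_mul, Complex.norm_real, Real.norm_of_nonneg (by positivity)]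
          exact hfar x hx0 y hy
        · rw [norm_mul, he1, mul_one]
      · rw [hP]
        simp only [indicator_of_notMem hy, norm_zero]
        positivity
    · refine Eventually.of_forall fun y => ?_
      have h1 := ((hker y).mul_const (S y)).norm
      rw [zero_mul, norm_zero] at h1
      refine squeeze_zero_norm (fun x => ?_) h1
      rw [← hA]
      exact norm_indicator_le_norm_self _ _
  -- Near region of the plane wave integral: a fixed `y` leaves the ball `N x` as soon as `‖x‖ >
  -- 2‖y‖`.
  set Z : Rn n → Rn n → ℝ := fun x y => (N x).indicator (fun y => ‖S y‖) y with hZ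
  have t3 : Tendsto (fun x : Rn n => ‖A‖ * ∫ y, Z x y) (cobounded (Rn n)) (𝓝 0) := by
    have := tendsto_integral_filter_of_dominated_convergence (l := cobounded (Rn n)) (F := Z)
      (f := fun _ => 0) (μ := volume) (fun y => ‖S y‖) ?_ ?_ hS.norm ?_
    · simpa using this.const_mul ‖A‖
    · exact Eventually.of_forall fun x => hS.norm.1.indicator (hNm x)
    · exact Eventually.of_forall fun x => Eventually.of_forall fun y =>
        (norm_indicator_le_norm_self _ _).trans (by simp)
    · refine Eventually.of_forall fun y => tendsto_const_nhds.congr' ?_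
      filter_upwards [tendsto_norm_cobounded_atTop.eventually (eventually_gt_atTop (2 * ‖y‖))]
        with x hx
      have hy : y ∉ N x := by
        simp only [hN, mem_closedBall_iff_norm, norm_sub_rev y x, not_le]
        linarith [norm_sub_norm_le x y]
      simp [hZ, hy]
  have tsum := (t1.add t2.norm).add t3
  simp only [norm_zero, add_zero] at tsum
  rw [← isLittleO_norm_left]
  refine isLittleO_of_tendsto' ?_ ?_
  · filter_upwards [hlarge] with x hx h0
    have hx0 : 0 < ‖x‖ := by linarith
    exact absurd h0 (by positivity)
  refine squeeze_zero' (Eventually.of_forall fun x => by positivity) ?_ tsum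
  filter_upwards [hlarge] with x hx
  have hx0 : 0 < ‖x‖ := by linarith
  have hxs : (0 : ℝ) < ‖x‖ ^ s := by positivity
  have hxsc : ((‖x‖ ^ s : ℝ) : ℂ) ≠ 0 := by exact_mod_cast hxs.ne'
  have hGi := hInt x hx
  have hEi : Integrable fun y => e x y * S y :=
    hS.bdd_mul (hec x).aestronglyMeasurable (c := 1) (Eventually.of_forall fun y => (he1 x y).le)
  have hEe : Complex.exp (Complex.I * (k : ℂ) * (‖x‖ : ℂ))
      * ∫ y, Complex.exp (-(Complex.I * (k : ℂ) * ((inner ℝ (‖x‖⁻¹ • x) y : ℝ) : ℂ))) * S y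
      = ∫ y, e x y * S y := by
    rw [← integral_const_mul]
    exact integral_congr_ae (Eventually.of_forall fun y => by simp only [he]; ring)
  have hPi : ∫ y, P x y = ((‖x‖ ^ s : ℝ) : ℂ) * (∫ y in (N x)ᶜ, greenFn n k ‖x - y‖ * S y)
      - A * ∫ y in (N x)ᶜ, e x y * S y := by
    rw [hP, integral_indicator (hNm x).compl, ← integral_const_mul, ← integral_const_mul,
      ← integral_sub (hGi.integrableOn.const_mul _) (hEi.integrableOn.const_mul _)]
    exact integral_congr_ae (Eventually.of_forall fun y => by ring)
  -- The rescaled remainder is the near kernel integral plus the far difference minus the near plane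
  -- wave integral, matching the three limits above.
  have hsplit : ((‖x‖ ^ s : ℝ) : ℂ) * ((∫ y, greenFn n k ‖x - y‖ * S y)
          - farFieldConst n
            * (Complex.exp (Complex.I * (k : ℂ) * (‖x‖ : ℂ))
                * ((k ^ (((n : ℝ) - 3) / 2) : ℝ) : ℂ) / ((‖x‖ ^ s : ℝ) : ℂ))
            * ∫ y, Complex.exp (-(Complex.I * (k : ℂ) * ((inner ℝ (‖x‖⁻¹ • x) y : ℝ) : ℂ))) * S y)
      = ((‖x‖ ^ s : ℝ) : ℂ) * (∫ y in N x, greenFn n k ‖x - y‖ * S y) + (∫ y, P x y)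
        - A * ∫ y in N x, e x y * S y := by
    rw [hPi]
    have e1 := integral_add_compl (hNm x) hGi
    have e2 := integral_add_compl (hNm x) hEi
    rw [← e1]
    have e3 : A * ∫ y, e x y * S y = ((‖x‖ ^ s : ℝ) : ℂ) * (farFieldConst n
            * (Complex.exp (Complex.I * (k : ℂ) * (‖x‖ : ℂ))
                * ((k ^ (((n : ℝ) - 3) / 2) : ℝ) : ℂ) / ((‖x‖ ^ s : ℝ) : ℂ))
            * ∫ y, Complex.exp (-(Complex.I * (k : ℂ) * ((inner ℝ (‖x‖⁻¹ • x) y : ℝ) : ℂ)))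
              * S y) := by
      rw [← hEe, hA]
      field_simp
    rw [mul_sub, ← e3, ← e2]
    ring
  have hnm : ∀ w : ℂ, ‖x‖ ^ s * ‖w‖ = ‖((‖x‖ ^ s : ℝ) : ℂ) * w‖ := fun w => by
    rw [norm_mul, Complex.norm_real, Real.norm_of_nonneg hxs.le]
  rw [one_div, div_inv_eq_mul, mul_comm, hnm, hsplit]
  refine (norm_sub_le _ _).trans (add_le_add ((norm_add_le _ _).trans (add_le_add_left ?_ _)) ?_)
  · rw [← hnm]
    calc ‖x‖ ^ s * ‖∫ y in N x, greenFn n k ‖x - y‖ * S y‖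
        ≤ ‖x‖ ^ s * (K * ‖x‖ ^ (1 / 2 - a)) := by
          gcongr
          exact (norm_integral_le_integral_norm _).trans (hK x hx).2
      _ = K * ‖x‖ ^ ((n : ℝ) / 2 - a) := by
          rw [mul_left_comm, ← Real.rpow_add hx0]
          congr 2
          rw [hs]; ring
  · rw [norm_mul]
    refine mul_le_mul_of_nonneg_left ?_ (norm_nonneg _)
    rw [hZ, integral_indicator (hNm x)]
    refine (norm_integral_le_integral_norm _).trans (le_of_eq ?_)
    exact integral_congr_ae (Eventually.of_forall fun y => by simp [he1])

end MagneticScattering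

/-! ### Far field asymptotics of the operator `Lk` -/

theorem lemma2p3 (n : ℕ) (hn : n = 2 ∨ n = 3)
    (p : ℝ≥0∞) (hp3 : n = 3 → 3 ≤ p) (hp2 : n = 2 → 2 < p)
    (δ : ℝ) (hδ : ((n : ℝ) + 1) / 2 - (n : ℝ) * (p⁻¹).toReal < δ)
    (μ : ℝ) (hμ : 2 < μ)
    (W : Rn n → Rn n) (V : Rn n → ℝ) (hWV : Admissible p δ μ W V)
    (δ₀ : ℝ) (hδ₀ : 1 / 2 < δ₀) (hδ₀μ : 2 * δ₀ + 1 < μ)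
    (k : ℝ) (hk : 0 < k) (f : Rn n → ℂ) (hf : MemWeightedH1 (-δ₀) f) :
    -- all the terms of the expansion are well defined
    (∃ d : Rn n → ℂ, IsWeakDiv (mulField W f) d) ∧
    Integrable (source W V f) volume ∧
    (∀ᶠ x in cobounded (Rn n),
      Integrable (fun y => greenFn n k ‖x - y‖ * source W V f y) volume) ∧
    -- the expansion, uniformly in the direction of `x`
    (fun x : Rn n =>
        Lk W V k f x
          - farFieldConst n
            * (Complex.exp (Complex.I * (k : ℂ) * (‖x‖ : ℂ))
                * ((k ^ (((n : ℝ) - 3) / 2) : ℝ) : ℂ)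
                / ((‖x‖ ^ (((n : ℝ) - 1) / 2) : ℝ) : ℂ))
            * farFieldIntegral W V k f (‖x‖⁻¹ • x))
      =o[cobounded (Rn n)] fun x : Rn n => 1 / ‖x‖ ^ (((n : ℝ) - 1) / 2) := by
  -- With `p ≥ 2`, local `L^p` bounds on `∇·W` and `V` become local `L²` bounds.
  have hp : 2 ≤ p := by
    rcases hn with h | h
    · exact (hp2 h).le
    · exact le_trans (by norm_num) (hp3 h)
  have hn3 : (n : ℝ) ≤ 3 := by rcases hn with rfl | rfl <;> norm_num
  -- The decay exponent suffices: `2(μ - δ₀) > 2δ₀ + 2 > 3 ≥ n`.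
  obtain ⟨hdiv, hInt, h, c, R, hh, hc, hR, hdec⟩ := source_estimate hp (by linarith) hWV
    (by linarith) (by linarith : (n : ℝ) < 2 * (μ - δ₀)) hf
  exact ⟨hdiv, hInt, farField_expansion hn hk hInt hh hc hR (by linarith) hdec⟩
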